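/- For $k\ge 0$ write $B_1^k=\{a\in\mathbb R^k:\sum_i|a_i|\le 1\}$, $B_2^k=\{a:\sum_i a_i^2\le 1\}$, $B_\infty^k=\{a:\max_i|a_i|\le 1\}$. For sets $A\subset V$, $L\subset W$ in finite-dimensional real vector spaces put $$d(A,L)=\inf\{\alpha/\beta:\ \alpha,\beta>0,\ \beta L\subset R(A)\subset\alpha L\text{ for some linear isomorphism }R:V\to W\}.$$ A contact point of a set $K\subset\mathbb R^n$ is a point of $\partial K$ of Euclidean norm $1$; $[\,\cdot\,]$ is the integer part. Let $K\subset\mathbb R^n$ be a convex body (compact, convex, with non-empty interior) and let $\varepsilon\in(0,1)$. Suppose first that $B_2^n$ is the ellipsoid of minimal volume containing $K$ (ellipsoids may have any centre). Then: (i) There are an integer $k\ge[(1-\varepsilon)n]$, an orthogonal projection $P$ of $\mathbb R^n$ of rank $k$ and contact points $x_1,\dots,x_k$ of $K$ such that $Px_1,\dots,Px_k$ is a basis of the range of $P$ and, for the linear isomorphism $T:\mathbb R^k\to P\mathbb R^n$, $Te_j=Px_j$, $$\frac{\varepsilon}{4}\,T(B_1^k)\subset PK\subset\frac{16}{\varepsilon^2}\,T(B_2^k).$$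 Moreover, with $PK$ regarded as a subset of $P\mathbb R^n$, $d(PK,B_1^k)\le 64\sqrt n/\varepsilon^3$. (ii) There are an integer $k\ge[(1-\varepsilon)n]$, a subspace $E\subset\mathbb R^n$ of dimension $k$ and a linear isomorphism $S:\mathbb R^k\to E$ such that $$\frac{\varepsilon^2}{16}\,S(B_2^k)\subset K\cap E\subset\frac4\varepsilon\,S(B_\infty^k).$$ Moreover, with $K\cap E$ regarded as a subset of $E$, $d(K\cap E,B_\infty^k)\le 64\sqrt n/\varepsilon^3$. Suppose now instead that $B_2^n$ is the ellipsoid of maximal volume contained in $K$. Then: (iii) All the conclusions of (ii) hold for some $k$, $E$, $S$ for which there are moreover contact points $x_1,\dots,x_k$ of $K$ with $\langle Sa,x_j\rangle=a_j$ for all $a\in\mathbb R^k$ and $1\le j\le k$. -/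

import Mathlib

open scoped Pointwise ENNReal

noncomputable section

/-- Ellipsoids in `ℝⁿ`: images of the closed Euclidean unit ball under invertible affine maps
(so the centre is arbitrary). -/
def IsEllipsoid {n : ℕ} (S : Set (EuclideanSpace ℝ (Fin n))) : Prop :=
  ∃ φ : EuclideanSpace ℝ (Fin n) ≃ᵃ[ℝ] EuclideanSpace ℝ (Fin n),
    S = φ '' Metric.closedBall 0 1

/-- `S` is the ellipsoid of minimal volume containing `K`. -/
def IsMinVolumeEllipsoid {n : ℕ} (S K : Set (EuclideanSpace ℝ (Fin n))) : Prop :=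
  IsEllipsoid S ∧ K ⊆ S ∧
    ∀ S' : Set (EuclideanSpace ℝ (Fin n)), IsEllipsoid S' → K ⊆ S' →
      MeasureTheory.volume S ≤ MeasureTheory.volume S'

/-- `S` is the ellipsoid of maximal volume contained in `K`. -/
def IsMaxVolumeEllipsoid {n : ℕ} (S K : Set (EuclideanSpace ℝ (Fin n))) : Prop :=
  IsEllipsoid S ∧ S ⊆ K ∧
    ∀ S' : Set (EuclideanSpace ℝ (Fin n)), IsEllipsoid S' → S' ⊆ K →
      MeasureTheory.volume S' ≤ MeasureTheory.volume S

/-- The contact points of `K` with the Euclidean unit ball: common points of the boundary of `K`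
and the unit sphere. -/
def contactPoints {n : ℕ} (K : Set (EuclideanSpace ℝ (Fin n))) :
    Set (EuclideanSpace ℝ (Fin n)) :=
  frontier K ∩ Metric.sphere 0 1

/-- The unit ball `B_1^k` of `ℓ_1^k`. -/
def unitBallOne (k : ℕ) : Set (EuclideanSpace ℝ (Fin k)) :=
  {a | ∑ i, |a i| ≤ 1}

/-- The Euclidean unit ball `B_2^k`. -/
def unitBallTwo (k : ℕ) : Set (EuclideanSpace ℝ (Fin k)) :=
  Metric.closedBall 0 1

/-- The unit cube `B_∞^k`, the unit ball of `ℓ_∞^k`. -/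
def unitBallInf (k : ℕ) : Set (EuclideanSpace ℝ (Fin k)) :=
  {a | ∀ i, |a i| ≤ 1}

/-- The Banach-Mazur distance
`d(K, L) = inf {α / β : β L ⊆ T K ⊆ α L}` with `α, β > 0` and `T` a linear isomorphism (no
translations). It takes values in `[0, ∞]`, with value `∞` if there is no admissible triple. -/
def banachMazurDist {V W : Type*} [AddCommGroup V] [Module ℝ V] [AddCommGroup W] [Module ℝ W]
    (K : Set V) (L : Set W) : ℝ≥0∞ :=
  ⨅ (T : V ≃ₗ[ℝ] W) (α : ℝ) (β : ℝ) (_ : 0 < α) (_ : 0 < β)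
    (_ : β • L ⊆ T '' K ∧ T '' K ⊆ α • L), ENNReal.ofReal (α / β)

end

/-! When the unit ball is the minimal ellipsoid around L, John's theorem (`exists_decomposition`)
gives unit vectors x_i of L and weights with Σ c_i x_i ⊗ x_i = I and Σ c_i x_i = 0. Restricted
invertibility (`exists_lower_riesz`, a barrier argument on Gram matrices) then selects a large
proportion of them with a lower ℓ₂ bound. As L lies in the unit ball, such a bound puts PL inside a
multiple of T(B_2).

The inner inclusion needs negatives of the Px_j, which L need not supply. So some surplus vectors
are selected too, the main vectors are split into groups of at most ⌊4/ε⌋, each group receives one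
surplus vector, and P kills every group sum (`exists_subspace_of_groups`). Then -Px_j is a sum of at
most 4/ε points of PL, whence -(ε/4)Px_j ∈ PL. The lower bound loses only a factor of order
ε^(-1/2). If εn ≤ 4 no grouping is needed, because L contains the ball of radius 1/n.

Sections are dual to projections of the polar (`exists_section_of_projection`). If the unit ball is
the maximal ellipsoid in K, the polar of K is already in Löwner position. If it is the minimal
ellipsoid around K, the polar is first moved there by an affine map; its translation is invisible on
vectors orthogonal to one direction b, so avoiding b costs a single dimension. -/

/-! ### Restricted invertibility by a barrier potential. -/

/-- Schur complement: adjoining one vector to a family borders its shifted Gram matrix by one row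
and column, and both positivity and the change of the inverse trace are governed by the scalar m -
gᵀD⁻¹g. -/
theorem Matrix.PosDef.fromBlocks_unit {κ : Type*} [Fintype κ] [DecidableEq κ]
    {D : Matrix κ κ ℝ} (hD : D.PosDef) (g : κ → ℝ) (m : ℝ)
    (hs : 0 < m - g ⬝ᵥ (D⁻¹.mulVec g)) :
    (Matrix.fromBlocks D (Matrix.replicateCol Unit g) (Matrix.replicateRow Unit g)
      (Matrix.of fun _ _ => m)).PosDef ∧
    (Matrix.fromBlocks D (Matrix.replicateCol Unit g) (Matrix.replicateRow Unit g)
      (Matrix.of fun _ _ => m))⁻¹.trace =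
      D⁻¹.trace + (1 + D⁻¹.mulVec g ⬝ᵥ D⁻¹.mulVec g) / (m - g ⬝ᵥ (D⁻¹.mulVec g)) := by
  have hDdet : IsUnit D.det := (Matrix.isUnit_iff_isUnit_det _).1 hD.isUnit
  let hinv : Invertible D := Matrix.invertibleOfIsUnitDet D hDdet
  set s := m - g ⬝ᵥ (D⁻¹.mulVec g) with hsdef
  set z := D⁻¹.mulVec g with hz
  have hschur : (Matrix.of fun _ _ => m : Matrix Unit Unit ℝ) -
      Matrix.replicateRow Unit g * D⁻¹ * Matrix.replicateCol Unit g = s • 1 := by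
    ext i j
    simp [Matrix.mul_assoc, Matrix.mul_apply, hsdef, dotProduct, Matrix.mulVec, hz]
  have hz' : Matrix.vecMul g D⁻¹ = z := by
    rw [hz, ← Matrix.mulVec_transpose, Matrix.transpose_nonsing_inv]
    congr 2
    exact (Matrix.conjTranspose_eq_transpose_of_trivial D).symm.trans hD.isHermitian
  have hDz : D.mulVec z = g := by
    rw [hz, Matrix.mulVec_mulVec, Matrix.mul_nonsing_inv _ hDdet, Matrix.one_mulVec]
  constructor
  · have h1 : (Matrix.fromBlocks D (Matrix.replicateCol Unit g)
        (Matrix.replicateCol Unit g).conjTranspose (Matrix.of fun _ _ => m)).PosSemidef := by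
      rw [hD.fromBlocks₁₁]
      have : (Matrix.replicateCol Unit g).conjTranspose = Matrix.replicateRow Unit g := by
        ext; simp
      rw [this, hschur]
      exact Matrix.PosSemidef.one.smul hs.le
    have : (Matrix.replicateCol Unit g).conjTranspose = Matrix.replicateRow Unit g := by
      ext; simp
    rw [this] at h1
    rw [h1.posDef_iff_det_ne_zero, Matrix.det_fromBlocks₁₁, Matrix.invOf_eq_nonsing_inv, hschur]
    simp [hDdet.ne_zero, hs.ne']
  · have key : (Matrix.fromBlocks D (Matrix.replicateCol Unit g) (Matrix.replicateRow Unit g)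
      (Matrix.of fun _ _ => m))⁻¹ = Matrix.fromBlocks (D⁻¹ + s⁻¹ • Matrix.vecMulVec z z)
        (Matrix.replicateCol Unit (-s⁻¹ • z)) (Matrix.replicateRow Unit (-s⁻¹ • z))
        (Matrix.of fun _ _ => s⁻¹) := by
      apply Matrix.inv_eq_right_inv
      rw [Matrix.fromBlocks_multiply, ← Matrix.fromBlocks_one]
      congr 1
      · rw [Matrix.mul_add, Matrix.mul_nonsing_inv _ hDdet, Matrix.mul_smul,
          Matrix.mul_vecMulVec, hDz]
        ext i j
        simp [Matrix.mul_apply, Matrix.vecMulVec_apply]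
        ring
      · ext i j
        have := congrFun hDz i
        simp only [Matrix.mulVec, dotProduct] at this
        simp only [Matrix.add_apply, Matrix.mul_apply, Matrix.replicateCol_apply, Pi.smul_apply,
          smul_eq_mul, Matrix.of_apply, Finset.univ_unique, Finset.sum_singleton,
          Matrix.zero_apply]
        rw [← this, Finset.sum_mul, ← Finset.sum_add_distrib]
        apply Finset.sum_eq_zero
        intros; ring
      · ext i j
        have h2 := congrFun hz' j
        simp only [Matrix.vecMul, dotProduct] at h2
        have h3 : g ⬝ᵥ z = m - s := by rw [hsdef]; ring
        simp only [dotProduct] at h3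
        simp only [Matrix.add_apply, Matrix.mul_apply, Matrix.replicateRow_apply, Pi.smul_apply,
          smul_eq_mul, Matrix.of_apply, Finset.univ_unique, Finset.sum_singleton,
          Matrix.zero_apply, Matrix.vecMulVec_apply, Matrix.smul_apply, mul_add,
          Finset.sum_add_distrib]
        rw [h2]
        have : ∑ x, g x * (s⁻¹ * (z x * z j)) = s⁻¹ * z j * ∑ x, g x * z x := by
          rw [Finset.mul_sum]; apply Finset.sum_congr rfl; intros; ring
        rw [this, h3]
        field_simp
        ring
      · ext i j
        have h3 : g ⬝ᵥ z = m - s := by rw [hsdef]; ring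
        simp only [dotProduct] at h3
        simp only [Matrix.add_apply, Matrix.mul_apply, Matrix.replicateRow_apply, Pi.smul_apply,
          smul_eq_mul, Matrix.of_apply, Finset.univ_unique, Finset.sum_singleton,
          Matrix.replicateCol_apply]
        have : ∑ x, g x * (-s⁻¹ * z x) = -s⁻¹ * ∑ x, g x * z x := by
          rw [Finset.mul_sum]; apply Finset.sum_congr rfl; intros; ring
        rw [this, h3, Subsingleton.elim i j, Matrix.one_apply_eq]
        field_simp
        ring
    rw [key, Matrix.trace, Fintype.sum_sum_type]
    simp only [Matrix.diag_apply, Matrix.fromBlocks_apply₁₁, Matrix.fromBlocks_apply₂₂]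
    simp only [← Matrix.diag_apply, ← Matrix.trace.eq_1]
    simp only [Matrix.trace_add, Matrix.trace_smul, Matrix.trace_vecMulVec, smul_eq_mul]
    simp [Matrix.trace]
    field_simp
    ring

/-- The numerical core of `barrier_step`. Here τ' and τ are the inverse traces at the barriers b and
b', Δ is the gain in potential from lowering the barrier alone, and 1/b' is the loss from using up
one dimension. With t the excess of the potential over N, the claim reduces to (t + Δ)Δ ≥ (r -
k)/b'² + τ2. -/
theorem barrier_arith {N r k b b' δ τ τ' τ2 Δ : ℝ} (hb : 0 < b) (hb' : 0 < b') (hδ : 0 < δ)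
    (hbb : b' = b - δ) (hτ2 : 0 ≤ τ2)
    (hΔ : Δ = τ' - τ + (r - k) * (1 / b' - 1 / b)) (hΔ' : δ * τ2 ≤ τ' - τ)
    (ht : 1 ≤ δ * ((r - k) / b - τ' - N)) (hk : b ≤ δ * (r - k)) :
    N + τ + b' * τ2 ≤ (r - N * b' - k - b' * τ) * (Δ - 1 / b') ∧ 0 ≤ Δ - 1 / b' := by
  set t := (r - k) / b - τ' - N with htdef
  set q := r - k with hq
  have hqpos : 0 < q := by
    by_contra h
    push Not at h
    nlinarith
  have htpos : 0 < t := by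
    by_contra h
    push Not at h
    nlinarith
  have h1 : q * (1 / b' - 1 / b) = δ * q / (b * b') := by
    field_simp
    rw [hbb]; ring
  have h2 : 1 / b' ≤ δ * q / (b * b') := by
    rw [div_le_div_iff₀ hb' (by positivity)]
    nlinarith
  have hΔ1 : δ * τ2 + δ * q / (b * b') ≤ Δ := by rw [hΔ, h1]; linarith
  have hΔ2 : 1 / b' ≤ Δ := by have : 0 ≤ δ * τ2 := by positivity
                              linarith
  have hΔ0 : 0 < Δ := lt_of_lt_of_le (by positivity) hΔ2
  refine ⟨?_, by linarith⟩
  have h3 : r - N * b' - k - b' * τ = b' * (t + Δ) := by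
    rw [hΔ, htdef]; field_simp; ring
  have h4 : N + τ = q / b' - (t + Δ) := by rw [hΔ, htdef]; field_simp; ring
  have h5 : (t + Δ) * (δ * τ2) ≥ τ2 := by
    nlinarith [mul_nonneg hΔ0.le (mul_nonneg hδ.le hτ2)]
  have h6 : (t + Δ) * (δ * q / (b * b')) ≥ q / b' ^ 2 := by
    have : b / b' ≤ (t + Δ) * δ := by
      have e : b / b' = 1 + δ * (1 / b') := by field_simp; rw [hbb]; ring
      rw [e]; nlinarith
    calc q / b' ^ 2 = (b / b') * (q / (b * b')) := by field_simp
      _ ≤ ((t + Δ) * δ) * (q / (b * b')) := by gcongr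
      _ = _ := by ring
  have h7 : (t + Δ) * (δ * τ2 + δ * q / (b * b')) ≤ (t + Δ) * Δ := by gcongr
  have h8 : q / b' ^ 2 + τ2 ≤ (t + Δ) * Δ := by linarith [mul_add (t + Δ) (δ * τ2) (δ * q / (b * b'))]
  rw [h3, h4]
  have h9 : b' * (t + Δ) * (Δ - 1 / b') = b' * ((t + Δ) * Δ) - (t + Δ) := by field_simp
  have h10 : b' * (q / b' ^ 2) = q / b' := by field_simp
  rw [h9]
  nlinarith

/-- `tr ((G-b)⁻¹) - tr ((G-b')⁻¹) ≥ (b - b') tr ((G-b')⁻²)`. -/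
theorem trace_resolvent_le {κ : Type*} [Fintype κ] [DecidableEq κ] {G : Matrix κ κ ℝ} {b b' : ℝ}
    (hbb : b' ≤ b) (hG : (G - b • (1 : Matrix κ κ ℝ)).PosDef)
    (hG' : (G - b' • (1 : Matrix κ κ ℝ)).PosDef) :
    (b - b') * ((G - b' • (1 : Matrix κ κ ℝ))⁻¹ * (G - b' • (1 : Matrix κ κ ℝ))⁻¹).trace ≤
      (G - b • (1 : Matrix κ κ ℝ))⁻¹.trace - (G - b' • (1 : Matrix κ κ ℝ))⁻¹.trace := by
  set A := G - b • (1 : Matrix κ κ ℝ) with hA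
  set B := G - b' • (1 : Matrix κ κ ℝ) with hB
  have hAu : IsUnit A.det := (Matrix.isUnit_iff_isUnit_det _).1 hG.isUnit
  have hBu : IsUnit B.det := (Matrix.isUnit_iff_isUnit_det _).1 hG'.isUnit
  have hAB : B - A = (b - b') • (1 : Matrix κ κ ℝ) := by rw [hA, hB, sub_smul]; abel
  -- Resolvent identity. Used a second time, it shows that tr(A⁻¹B⁻¹) exceeds tr(B⁻²) by (b - b')
  -- tr(B⁻¹A⁻¹B⁻¹) ≥ 0.
  have h1 : A⁻¹ - B⁻¹ = (b - b') • (A⁻¹ * B⁻¹) := by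
    calc A⁻¹ - B⁻¹ = A⁻¹ * (B - A) * B⁻¹ := by
          rw [Matrix.mul_sub, Matrix.sub_mul, Matrix.mul_assoc, Matrix.mul_nonsing_inv _ hBu,
            Matrix.nonsing_inv_mul _ hAu, Matrix.mul_one, Matrix.one_mul]
      _ = _ := by rw [hAB]; simp
  have hBs : B⁻¹.conjTranspose = B⁻¹ := hG'.inv.isHermitian
  have h2 : (A⁻¹ * B⁻¹).trace - (B⁻¹ * B⁻¹).trace = (b - b') * (B⁻¹ * A⁻¹ * B⁻¹).trace := by
    rw [← Matrix.trace_sub, ← Matrix.sub_mul, h1, Matrix.smul_mul, Matrix.trace_smul, smul_eq_mul,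
      Matrix.mul_assoc B⁻¹, Matrix.trace_mul_comm B⁻¹]
  have h3 : 0 ≤ (B⁻¹ * A⁻¹ * B⁻¹).trace := by
    have := (hG.inv.posSemidef.conjTranspose_mul_mul_same B⁻¹).trace_nonneg
    rwa [hBs] at this
  rw [← Matrix.trace_sub, h1, Matrix.trace_smul, smul_eq_mul]
  have : 0 ≤ b - b' := by linarith
  nlinarith [mul_nonneg this h3]

section Selection

variable {E : Type*} [NormedAddCommGroup E] [InnerProductSpace ℝ E] {ι : Type*} [Fintype ι]

/-- The Parseval identity turns a weighted average over candidate vectors into a trace against the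
Gram matrix of those already chosen. -/
theorem sum_weighted_quadForm_eq_trace {v : ι → E} {c : ι → ℝ}
    (hpar : ∀ i i', ∑ j, c j * (inner ℝ (v i) (v j) * inner ℝ (v j) (v i')) =
      inner ℝ (v i) (v i'))
    {κ : Type*} [Fintype κ] (σ : κ → ι) (B : Matrix κ κ ℝ) :
    ∑ j, c j * ((fun a => inner ℝ (v (σ a)) (v j)) ⬝ᵥ
      (B.mulVec fun a => inner ℝ (v (σ a)) (v j))) = (B * Matrix.gram ℝ (v ∘ σ)).trace := by
  simp only [Matrix.trace, Matrix.diag_apply, Matrix.mul_apply, Matrix.gram_apply, dotProduct,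
    Matrix.mulVec, Finset.mul_sum, Function.comp]
  rw [Finset.sum_comm]
  refine Finset.sum_congr rfl fun a _ => ?_
  rw [Finset.sum_comm]
  refine Finset.sum_congr rfl fun a' _ => ?_
  rw [← hpar, Finset.mul_sum]
  refine Finset.sum_congr rfl fun j _ => ?_
  rw [real_inner_comm (v (σ a)) (v j)]
  ring

/-- The potential (r - k)/b - tr((G - b)⁻¹) is minus the trace of the resolvent at b of Σ v ⊗ v on
an r-dimensional space: the r - k zero eigenvalues contribute 1/b each. Some vector can be added,
with the barrier lowered by δ, without decreasing it. -/
theorem barrier_step {v : ι → E} {c : ι → ℝ} (hc : ∀ j, 0 ≤ c j) {N r : ℝ} (hN : 0 < N)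
    (hcN : ∑ j, c j = N)
    (hpar : ∀ i i', ∑ j, c j * (inner ℝ (v i) (v j) * inner ℝ (v j) (v i')) =
      inner ℝ (v i) (v i'))
    (htr : ∑ j, c j * inner ℝ (v j) (v j) = r)
    {κ : Type*} [Fintype κ] [DecidableEq κ] (σ : κ → ι) {b b' δ : ℝ}
    (hb' : 0 < b') (hδ : 0 < δ) (hbb : b' = b - δ)
    (hG : (Matrix.gram ℝ (v ∘ σ) - b • (1 : Matrix κ κ ℝ)).PosDef)
    (ht : 1 ≤ δ * ((r - Fintype.card κ) / b -
      (Matrix.gram ℝ (v ∘ σ) - b • (1 : Matrix κ κ ℝ))⁻¹.trace - N))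
    (hk : b ≤ δ * (r - Fintype.card κ)) :
    ∃ j, (Matrix.gram ℝ (v ∘ Sum.elim σ fun _ : Unit => j) -
        b' • (1 : Matrix (κ ⊕ Unit) (κ ⊕ Unit) ℝ)).PosDef ∧
      (r - Fintype.card κ) / b - (Matrix.gram ℝ (v ∘ σ) - b • (1 : Matrix κ κ ℝ))⁻¹.trace ≤
      (r - (Fintype.card κ + 1)) / b' - (Matrix.gram ℝ (v ∘ Sum.elim σ fun _ : Unit => j) -
        b' • (1 : Matrix (κ ⊕ Unit) (κ ⊕ Unit) ℝ))⁻¹.trace := by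
  have hb : 0 < b := by linarith
  set G := Matrix.gram ℝ (v ∘ σ) with hGdef
  set A := G - b • (1 : Matrix κ κ ℝ) with hA
  set D := G - b' • (1 : Matrix κ κ ℝ) with hD
  have hDpos : D.PosDef := by
    have : D = A + δ • (1 : Matrix κ κ ℝ) := by rw [hA, hD, hbb, sub_smul]; abel
    rw [this]
    exact hG.add (Matrix.PosDef.one.smul hδ)
  have hDu : IsUnit D.det := (Matrix.isUnit_iff_isUnit_det _).1 hDpos.isUnit
  have hGD : G = D + b' • 1 := by rw [hD]; abel
  set Δ := A⁻¹.trace - D⁻¹.trace + (r - Fintype.card κ) * (1 / b' - 1 / b) with hΔ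
  have hres := trace_resolvent_le (by linarith : b' ≤ b) hG hDpos
  rw [show b - b' = δ by rw [hbb]; ring] at hres
  have hDs : D⁻¹.conjTranspose = D⁻¹ := hDpos.inv.isHermitian
  have hDt : D⁻¹.transpose = D⁻¹ := (Matrix.conjTranspose_eq_transpose_of_trivial _).symm.trans hDs
  have hτ2 : 0 ≤ (D⁻¹ * D⁻¹).trace := by
    have := (Matrix.posSemidef_conjTranspose_mul_self D⁻¹).trace_nonneg
    rwa [hDs] at this
  obtain ⟨hmain, hΔ0⟩ := barrier_arith (k := Fintype.card κ) hb hb' hδ hbb hτ2 hΔ hres ht hk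
  let g : ι → κ → ℝ := fun j a => inner ℝ (v (σ a)) (v j)
  let s : ι → ℝ := fun j => inner ℝ (v j) (v j) - b' - g j ⬝ᵥ (D⁻¹.mulVec (g j))
  have e1 : ∑ j, c j * (1 + D⁻¹.mulVec (g j) ⬝ᵥ D⁻¹.mulVec (g j)) =
      N + D⁻¹.trace + b' * (D⁻¹ * D⁻¹).trace := by
    have : ∀ j, D⁻¹.mulVec (g j) ⬝ᵥ D⁻¹.mulVec (g j) = g j ⬝ᵥ ((D⁻¹ * D⁻¹).mulVec (g j)) := by
      intro j
      rw [← Matrix.mulVec_mulVec, Matrix.dotProduct_mulVec (g j), ← Matrix.mulVec_transpose, hDt]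
    simp only [mul_add, mul_one, Finset.sum_add_distrib, hcN, this]
    rw [sum_weighted_quadForm_eq_trace hpar σ (D⁻¹ * D⁻¹), ← hGdef, hGD, Matrix.mul_add,
      Matrix.mul_assoc, Matrix.nonsing_inv_mul _ hDu]
    simp [Matrix.trace_add, add_assoc]
  have e2 : ∑ j, c j * (s j * (Δ - 1 / b')) =
      (r - N * b' - Fintype.card κ - b' * D⁻¹.trace) * (Δ - 1 / b') := by
    simp only [← mul_assoc]
    rw [← Finset.sum_mul]
    congr 1
    simp only [s, mul_sub, Finset.sum_sub_distrib, htr]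
    rw [sum_weighted_quadForm_eq_trace hpar σ D⁻¹, ← hGdef, ← Finset.sum_mul, hcN, hGD,
      Matrix.mul_add, Matrix.nonsing_inv_mul _ hDu]
    simp [Matrix.trace_add]
    ring
  -- Averaging with weights c: by `e1`, `e2` and `hmain` the inequality holds in total, so it cannot
  -- fail for every j. As the left side is at least 1, it also forces the Schur complement s j to be
  -- positive.
  obtain ⟨j, hj⟩ : ∃ j, 1 + D⁻¹.mulVec (g j) ⬝ᵥ D⁻¹.mulVec (g j) ≤ s j * (Δ - 1 / b') := by
    by_contra! hcon
    have hle : ∀ j ∈ Finset.univ, c j * (s j * (Δ - 1 / b')) ≤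
        c j * (1 + D⁻¹.mulVec (g j) ⬝ᵥ D⁻¹.mulVec (g j)) :=
      fun j _ => mul_le_mul_of_nonneg_left (hcon j).le (hc j)
    obtain ⟨j, hj⟩ : ∃ j, 0 < c j := by
      by_contra! h
      have : ∑ j, c j ≤ 0 := Finset.sum_nonpos fun j _ => h j
      linarith
    have := Finset.sum_lt_sum hle ⟨j, Finset.mem_univ _, mul_lt_mul_of_pos_left (hcon j) hj⟩
    rw [e1, e2] at this
    linarith
  have hz0 : 0 ≤ D⁻¹.mulVec (g j) ⬝ᵥ D⁻¹.mulVec (g j) := by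
    simp only [dotProduct]
    exact Finset.sum_nonneg fun i _ => mul_self_nonneg _
  have hs : 0 < s j := by
    by_contra h
    push Not at h
    nlinarith
  obtain ⟨h1, h2⟩ := hDpos.fromBlocks_unit (g j) (inner ℝ (v j) (v j) - b') hs
  have hblock : Matrix.gram ℝ (v ∘ Sum.elim σ fun _ : Unit => j) -
        b' • (1 : Matrix (κ ⊕ Unit) (κ ⊕ Unit) ℝ) =
      Matrix.fromBlocks D (Matrix.replicateCol Unit (g j)) (Matrix.replicateRow Unit (g j))
      (Matrix.of fun _ _ => inner ℝ (v j) (v j) - b') := by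
    ext (a | a) (a' | a')
    · simp [hD, hGdef, Matrix.one_apply]
    · simp [g]
    · simp [g, real_inner_comm]
    · simp
  refine ⟨j, by rw [hblock]; exact h1, ?_⟩
  rw [hblock, h2]
  have h3 : (1 + D⁻¹.mulVec (g j) ⬝ᵥ D⁻¹.mulVec (g j)) / (s j) ≤ Δ - 1 / b' := by
    rw [div_le_iff₀ hs]; linarith
  have h4 : (r - (Fintype.card κ + 1)) / b' - (r - Fintype.card κ) / b =
      (r - Fintype.card κ) * (1 / b' - 1 / b) - 1 / b' := by ring
  simp only [s] at h3
  linarith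

theorem exists_gram_sub_posDef {v : ι → E} {c : ι → ℝ} (hc : ∀ j, 0 ≤ c j) {N r : ℝ} (hN : 0 < N)
    (hcN : ∑ j, c j = N)
    (hpar : ∀ i i', ∑ j, c j * (inner ℝ (v i) (v j) * inner ℝ (v j) (v i')) =
      inner ℝ (v i) (v i'))
    (htr : ∑ j, c j * inner ℝ (v j) (v j) = r) {b₀ δ : ℝ} (hδ : 0 < δ)
    (ht : 1 ≤ δ * (r / b₀ - N)) (hr : b₀ ≤ δ * r) (k : ℕ) (hk : 0 < b₀ - k * δ) :
    ∃ σ : Fin k → ι, (Matrix.gram ℝ (v ∘ σ) - (b₀ - k * δ) • (1 : Matrix _ _ ℝ)).PosDef := by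
  -- Each step adjoins a point to the index type, so the induction runs over arbitrary finite types.
  -- The last conjunct is the invariant: the potential never falls below its initial value r/b₀.
  suffices ∃ (κ : Type) (_ : Fintype κ) (_ : DecidableEq κ) (σ : κ → ι), Fintype.card κ = k ∧
      (Matrix.gram ℝ (v ∘ σ) - (b₀ - k * δ) • (1 : Matrix κ κ ℝ)).PosDef ∧
      r / b₀ ≤ (r - k) / (b₀ - k * δ) -
        (Matrix.gram ℝ (v ∘ σ) - (b₀ - k * δ) • (1 : Matrix κ κ ℝ))⁻¹.trace by
    obtain ⟨κ, _, _, σ, hcard, hpd, -⟩ := this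
    let e : Fin k ≃ κ := (Fintype.equivFinOfCardEq hcard).symm
    refine ⟨σ ∘ e, ?_⟩
    convert! hpd.submatrix e.injective using 1
    ext i j
    simp [Matrix.one_apply]
  induction k with
  | zero =>
    refine ⟨Empty, inferInstance, inferInstance, Empty.elim, by simp, ?_, by simp⟩
    rw [Matrix.posDef_iff_dotProduct_mulVec]
    exact ⟨by ext i; exact i.elim, fun {x} hx => (hx (Subsingleton.elim _ _)).elim⟩
  | succ k ih =>
    push_cast at hk
    obtain ⟨κ, _, _, σ, hcard, hpd, htrace⟩ := ih (by linarith)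
    obtain ⟨j, h1, h2⟩ := barrier_step hc hN hcN hpar htr σ (b := b₀ - k * δ)
      (b' := b₀ - (k + 1) * δ) (by linarith) hδ (by ring) hpd
      (by rw [hcard]; refine ht.trans (mul_le_mul_of_nonneg_left (by linarith) hδ.le))
      (by rw [hcard]; linarith)
    rw [hcard] at h2
    push_cast
    exact ⟨κ ⊕ Unit, inferInstance, inferInstance, _, by simp [hcard], h1, htrace.trans h2⟩

/-- A restricted invertibility principle: among the vectors of a weighted Parseval frame there are
`s` vectors with a quantitative lower Riesz bound. -/
theorem exists_lower_riesz {v : ι → E} {c : ι → ℝ} (hc : ∀ j, 0 ≤ c j) {N r : ℝ} (hN : 0 < N)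
    (hcN : ∑ j, c j = N)
    (hpar : ∀ i i', ∑ j, c j * (inner ℝ (v i) (v j) * inner ℝ (v j) (v i')) =
      inner ℝ (v i) (v i'))
    (htr : ∑ j, c j * inner ℝ (v j) (v j) = r) (hrN : r ≤ N) (s : ℕ) (hs : s < r) :
    ∃ σ : Fin s → ι, ∀ a : Fin s → ℝ,
      ((r - s) / (2 * N)) ^ 2 * ∑ i, a i ^ 2 ≤ ‖∑ i, a i • v (σ i)‖ ^ 2 := by
  have hs0 : (0 : ℝ) ≤ s := s.cast_nonneg
  have hr0 : 0 < r := by linarith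
  set b₀ := (r - s) / (2 * N) with hb
  have hb0 : 0 < b₀ := div_pos (by linarith) (by linarith)
  have hrb : r - N * b₀ = (r + s) / 2 := by rw [hb]; field_simp; ring
  -- This δ turns the initial condition on the potential into an equality. After s steps the barrier
  -- stands at b₀(r - s)/(r + s), which is at least b₀² because r + s ≤ 2N.
  set δ := b₀ / (r - N * b₀) with hδ
  have hden : 0 < r - N * b₀ := by rw [hrb]; linarith
  have hδ0 : 0 < δ := div_pos hb0 hden
  have hbs : b₀ - s * δ = b₀ * ((r - s) / (r + s)) := by
    rw [hδ, hrb]; field_simp; ring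
  have hbs' : b₀ ^ 2 ≤ b₀ - s * δ := by
    rw [hbs, sq]
    refine mul_le_mul_of_nonneg_left ?_ hb0.le
    rw [hb]
    exact div_le_div_of_nonneg_left (by linarith) (by linarith) (by linarith)
  obtain ⟨σ, hσ⟩ := exists_gram_sub_posDef hc hN hcN hpar htr (b₀ := b₀) hδ0
    (by
      have : r / b₀ - N = (r - N * b₀) / b₀ := by field_simp
      rw [hδ, this, div_mul_div_cancel₀ hden.ne', div_self hb0.ne'])
    (by rw [hδ, div_mul_eq_mul_div, le_div_iff₀ hden]; nlinarith [mul_pos hN hb0])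
    s (lt_of_lt_of_le (by positivity) hbs')
  refine ⟨σ, fun a => ?_⟩
  have h1 := hσ.posSemidef.dotProduct_mulVec_nonneg a
  have h2 : ‖∑ i, a i • v (σ i)‖ ^ 2 = a ⬝ᵥ (Matrix.gram ℝ (v ∘ σ)).mulVec a := by
    rw [← real_inner_self_eq_norm_sq, sum_inner]
    simp only [inner_sum, dotProduct, Matrix.mulVec, Matrix.gram_apply, real_inner_smul_left,
      real_inner_smul_right, Function.comp, Finset.mul_sum]
    refine Finset.sum_congr rfl fun i _ => Finset.sum_congr rfl fun j _ => by ring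
  rw [h2]
  have h3 : a ⬝ᵥ a = ∑ i, a i ^ 2 := by simp [dotProduct, sq]
  simp only [star_trivial, Matrix.sub_mulVec, dotProduct_sub, Matrix.smul_mulVec,
    Matrix.one_mulVec, dotProduct_smul, smul_eq_mul, h3] at h1
  have : 0 ≤ ∑ i, a i ^ 2 := Finset.sum_nonneg fun i _ => sq_nonneg _
  nlinarith [mul_le_mul_of_nonneg_right hbs' this]

end Selection

/-! ### Löwner position and John's theorem. -/

/-- Carathéodory: the hull is the continuous image of a simplex times finitely many copies of S,
shorter combinations being padded with zero weights. -/
theorem IsCompact.convexHull_of_finiteDimensional {V : Type*} [NormedAddCommGroup V]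
    [NormedSpace ℝ V] [FiniteDimensional ℝ V] {S : Set V} (hS : IsCompact S) :
    IsCompact (convexHull ℝ S) := by
  rcases S.eq_empty_or_nonempty with rfl | ⟨s₀, hs₀⟩
  · simp
  let ι := Fin (Module.finrank ℝ V + 1)
  let Ψ : (ι → ℝ) × (ι → V) → V := fun p => ∑ i, p.1 i • p.2 i
  have hcomp : IsCompact ((stdSimplex ℝ ι) ×ˢ (Set.univ.pi fun _ : ι => S)) :=
    (isCompact_stdSimplex ℝ ι).prod (isCompact_univ_pi fun _ => hS)
  have hΨ : Continuous Ψ := by fun_prop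
  suffices convexHull ℝ S = Ψ '' ((stdSimplex ℝ ι) ×ˢ (Set.univ.pi fun _ : ι => S)) by
    rw [this]; exact hcomp.image hΨ
  apply Set.Subset.antisymm
  · intro x hx
    obtain ⟨κ, _, z, w, hz, hind, hw, hw1, hx⟩ := eq_pos_convex_span_of_mem_convexHull hx
    have hcard : Fintype.card κ ≤ Fintype.card ι := by
      have := hind.card_le_finrank_succ
      rw [Fintype.card_fin]
      exact this.trans (Nat.succ_le_succ (Submodule.finrank_le _))
    obtain ⟨e⟩ := Function.Embedding.nonempty_of_card_le hcard
    refine ⟨(Function.extend e w 0, Function.extend e z fun _ => s₀), ⟨⟨?_, ?_⟩, ?_⟩, ?_⟩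
    · intro i
      by_cases hi : ∃ k, e k = i
      · obtain ⟨k, rfl⟩ := hi
        simp only [e.injective.extend_apply]; exact (hw k).le
      · simp only [Function.extend_apply' _ _ _ hi]; exact le_rfl
    · rw [← hw1]
      refine (Fintype.sum_of_injective e e.injective _ _ (fun i hi => ?_) fun k => ?_).symm
      · simp only [Function.extend_apply' _ _ _ hi]; rfl
      · simp only [e.injective.extend_apply]
    · intro i _
      by_cases hi : ∃ k, e k = i
      · obtain ⟨k, rfl⟩ := hi
        simp only [e.injective.extend_apply]; exact hz (Set.mem_range_self k)
      · simp only [Function.extend_apply' _ _ _ hi]; exact hs₀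
    · rw [← hx]
      refine (Fintype.sum_of_injective e e.injective _ _ (fun i hi => ?_) fun k => ?_).symm
      · simp only [Function.extend_apply' _ _ _ hi, Pi.zero_apply, zero_smul]
      · simp only [e.injective.extend_apply]
  · rintro _ ⟨⟨w, z⟩, ⟨⟨hw, hw1⟩, hz⟩, rfl⟩
    exact mem_convexHull_of_exists_fintype w z hw hw1 (fun i => hz i trivial) rfl

/-- A compact convex set for which the Euclidean unit ball is an ellipsoid of minimal volume
containing it. -/
structure IsLoewnerPosition {n : ℕ} (L : Set (EuclideanSpace ℝ (Fin n))) : Prop where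
  isCompact : IsCompact L
  convex : Convex ℝ L
  nonempty : L.Nonempty
  norm_le : ∀ y ∈ L, ‖y‖ ≤ 1
  abs_det_le : ∀ (A : EuclideanSpace ℝ (Fin n) →ₗ[ℝ] EuclideanSpace ℝ (Fin n))
    (b : EuclideanSpace ℝ (Fin n)), (∀ y ∈ L, ‖A y - b‖ ≤ 1) → |LinearMap.det A| ≤ 1

namespace IsLoewnerPosition

variable {n : ℕ} {L : Set (EuclideanSpace ℝ (Fin n))}

/-- First-order variation y ↦ y - t(Hy + h). The squared norm changes by -2tφ(y) + O(t²) with φ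
positive at contact points, while the determinant is 1 - t tr H + O(t²). -/
theorem exists_det_gt_one (hL : IsCompact L) (hL1 : ∀ y ∈ L, ‖y‖ ≤ 1)
    (h : EuclideanSpace ℝ (Fin n)) (H : Matrix (Fin n) (Fin n) ℝ) (htr : H.trace < 0)
    (hpos : ∀ y ∈ L, ‖y‖ = 1 → 0 < inner ℝ h y + inner ℝ y (H.toEuclideanLin y)) :
    ∃ (A : EuclideanSpace ℝ (Fin n) →ₗ[ℝ] EuclideanSpace ℝ (Fin n))
      (b : EuclideanSpace ℝ (Fin n)), (∀ y ∈ L, ‖A y - b‖ ≤ 1) ∧ 1 < LinearMap.det A := by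
  set T := H.toEuclideanLin with hT
  have hTc : Continuous T := T.continuous_of_finiteDimensional
  let φ : EuclideanSpace ℝ (Fin n) → ℝ := fun y => inner ℝ h y + inner ℝ y (T y)
  have hφ : Continuous φ := by fun_prop
  -- By compactness each point of L is either uniformly inside the sphere or has φ uniformly
  -- positive.
  obtain ⟨γ, hγ, hγL⟩ : ∃ γ > 0, ∀ y ∈ L, γ ≤ max (1 - ‖y‖ ^ 2) (φ y) := by
    rcases L.eq_empty_or_nonempty with rfl | hne
    · exact ⟨1, one_pos, by simp⟩
    obtain ⟨y₀, hy₀, hmin⟩ := hL.exists_isMinOn hne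
      (f := fun y => max (1 - ‖y‖ ^ 2) (φ y)) (by fun_prop)
    refine ⟨max (1 - ‖y₀‖ ^ 2) (φ y₀), ?_, fun y hy => hmin hy⟩
    rcases (hL1 y₀ hy₀).lt_or_eq with h1 | h1
    · exact lt_max_of_lt_left (by nlinarith [norm_nonneg y₀])
    · exact lt_max_of_lt_right (hpos y₀ hy₀ h1)
  obtain ⟨C₁, hC₁⟩ := hL.exists_bound_of_continuousOn (f := φ) hφ.continuousOn
  obtain ⟨C₂, hC₂⟩ := hL.exists_bound_of_continuousOn (f := fun y => ‖T y + h‖ ^ 2) (by fun_prop)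
  set C := max 1 (max C₁ C₂) with hC
  have hC1 : 1 ≤ C := le_max_left _ _
  set e := (Matrix.det (1 + (Polynomial.X : Polynomial ℝ) • H.map Polynomial.C)).divX.divX
  have hev : ∀ᶠ t in nhdsWithin (0 : ℝ) (Set.Ioi 0), 0 < -H.trace + e.eval (-t) * t := by
    refine Filter.Eventually.filter_mono nhdsWithin_le_nhds ?_
    have hcont : Continuous fun t : ℝ => -H.trace + e.eval (-t) * t := by fun_prop
    exact continuousAt_const.eventually_lt hcont.continuousAt (by simpa using htr)
  obtain ⟨t, ht1, ht0, ht2⟩ := (hev.and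
    (Ioo_mem_nhdsGT (show (0 : ℝ) < min 1 (γ / (3 * C)) by positivity))).exists
  have ht3 : t ≤ 1 := ht2.le.trans (min_le_left _ _)
  have ht4 : 3 * C * t ≤ γ := by
    have := ht2.le.trans (min_le_right _ _)
    rw [le_div_iff₀ (by positivity)] at this
    linarith
  let A : EuclideanSpace ℝ (Fin n) →ₗ[ℝ] EuclideanSpace ℝ (Fin n) := LinearMap.id - t • T
  refine ⟨A, t • h, fun y hy => ?_, ?_⟩
  · have hexp : ‖A y - t • h‖ ^ 2 =
        ‖y‖ ^ 2 - 2 * t * φ y + t ^ 2 * ‖T y + h‖ ^ 2 := by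
      have : A y - t • h = y - t • (T y + h) := by
        simp only [A, LinearMap.sub_apply, LinearMap.id_apply, LinearMap.smul_apply, smul_add]
        abel
      rw [this, norm_sub_sq_real, inner_smul_right, inner_add_right, norm_smul, mul_pow,
        Real.norm_eq_abs, sq_abs, real_inner_comm h y]
      simp only [φ]
      ring
    have hb1 : |φ y| ≤ C := (hC₁ y hy).trans ((le_max_left _ _).trans (le_max_right _ _))
    have hb2 : ‖T y + h‖ ^ 2 ≤ C := (le_abs_self _).trans
      ((hC₂ y hy).trans ((le_max_right _ _).trans (le_max_right _ _)))
    have hb3 : t ^ 2 * ‖T y + h‖ ^ 2 ≤ t * (t * C) := by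
      rw [sq, mul_assoc]; gcongr
    have hy1 := hL1 y hy
    have hsq : ‖A y - t • h‖ ^ 2 ≤ 1 := by
      rw [hexp]
      rcases le_max_iff.1 (hγL y hy) with h1 | h1
      · have : -(t * C) ≤ t * φ y := by nlinarith [neg_le_of_abs_le hb1]
        nlinarith [mul_nonneg ht0.le (by linarith : (0:ℝ) ≤ C)]
      · have : t * γ ≤ t * φ y := by gcongr
        have : t * (t * C) ≤ t * γ := by
          gcongr
          nlinarith [mul_nonneg ht0.le (by linarith : (0:ℝ) ≤ C)]
        nlinarith [norm_nonneg y, mul_pos ht0 hγ]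
    nlinarith [norm_nonneg (A y - t • h)]
  · have hdet : LinearMap.det A = Matrix.det (1 + (-t) • H) := by
      have : A = Matrix.toLin (EuclideanSpace.basisFun (Fin n) ℝ).toBasis
          (EuclideanSpace.basisFun (Fin n) ℝ).toBasis (1 + (-t) • H) := by
        simp only [A]
        rw [map_add, map_smul, Matrix.toLin_one, neg_smul, ← sub_eq_add_neg, hT,
          Matrix.toEuclideanLin_eq_toLin_orthonormal]
      rw [this, LinearMap.det_toLin]
    rw [hdet, Matrix.det_one_add_smul]
    have := mul_pos ht0 ht1
    nlinarith

/-- John's theorem: a decomposition of the identity by contact points. -/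
theorem exists_decomposition (hL : IsLoewnerPosition L) :
    ∃ (ι : Type) (_ : Fintype ι) (c : ι → ℝ) (x : ι → EuclideanSpace ℝ (Fin n)),
      (∀ i, 0 ≤ c i) ∧ ∑ i, c i = n ∧ (∀ i, x i ∈ L) ∧ (∀ i, ‖x i‖ = 1) ∧
      ∑ i, c i • x i = 0 ∧
      ∀ u w, ∑ i, c i * (inner ℝ u (x i) * inner ℝ (x i) w) = inner ℝ u w := by
  rcases Nat.eq_zero_or_pos n with rfl | hn
  · exact ⟨Empty, inferInstance, fun _ => 0, fun _ => 0, by simp, by simp, by simp, by simp,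
      by simp, fun u w => by simp [Subsingleton.elim u 0]⟩
  have hn' : (0 : ℝ) < n := by exact_mod_cast hn
  let Φ : EuclideanSpace ℝ (Fin n) → EuclideanSpace ℝ (Fin n) × (Fin n → Fin n → ℝ) :=
    fun x => (x, fun i j => x i * x j)
  have hΦ : Continuous Φ := by fun_prop
  have hΓ : IsCompact (L ∩ Metric.sphere 0 1) := hL.isCompact.inter_right Metric.isClosed_sphere
  -- Divided by n, John's identities say that (0, I/n) is a convex combination of pairs (x, x ⊗ x)
  -- over contact points x. Otherwise a separating functional yields a forbidden variation.
  let p₀ : EuclideanSpace ℝ (Fin n) × (Fin n → Fin n → ℝ) :=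
    (0, fun i j => if i = j then 1 / (n : ℝ) else 0)
  by_cases hp : p₀ ∈ convexHull ℝ (Φ '' (L ∩ Metric.sphere 0 1))
  · rw [mem_convexHull_iff_exists_fintype] at hp
    obtain ⟨ι, _, w, z, hw0, hw1, hz, hsum⟩ := hp
    choose x hx hxz using hz
    have hz' : ∀ i, z i = Φ (x i) := fun i => (hxz i).symm
    simp only [hz'] at hsum
    have hs1 := congrArg Prod.fst hsum
    have hs2 := congrArg Prod.snd hsum
    simp only [Prod.fst_sum, Prod.snd_sum, Prod.smul_fst, Prod.smul_snd, Φ, p₀] at hs1 hs2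
    refine ⟨ι, inferInstance, fun i => n * w i, x, fun i => mul_nonneg hn'.le (hw0 i), ?_,
      fun i => (hx i).1, fun i => by simpa using (hx i).2, ?_, fun u v => ?_⟩
    · rw [← Finset.mul_sum, hw1, mul_one]
    · simp only [mul_smul]
      rw [← Finset.smul_sum, hs1, smul_zero]
    · have h1 : ∀ a b, ∑ i, w i * (x i a * x i b) = if a = b then 1 / (n : ℝ) else 0 := by
        intro a b
        have := congrFun (congrFun hs2 a) b
        simpa [Finset.sum_apply] using this
      calc ∑ i, n * w i * (inner ℝ u (x i) * inner ℝ (x i) v)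
          = ∑ i, ∑ a, ∑ b, n * (u a * v b * (w i * (x i a * x i b))) := by
            refine Finset.sum_congr rfl fun i _ => ?_
            simp only [PiLp.inner_apply, RCLike.inner_apply, conj_trivial]
            rw [Finset.sum_mul_sum, Finset.mul_sum]
            refine Finset.sum_congr rfl fun a _ => ?_
            rw [Finset.mul_sum]
            refine Finset.sum_congr rfl fun b _ => by ring
        _ = ∑ a, ∑ b, n * (u a * v b * ∑ i, w i * (x i a * x i b)) := by
            rw [Finset.sum_comm]
            refine Finset.sum_congr rfl fun a _ => ?_
            rw [Finset.sum_comm]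
            refine Finset.sum_congr rfl fun b _ => ?_
            simp only [Finset.mul_sum]
        _ = inner ℝ u v := by
            simp only [h1, PiLp.inner_apply, RCLike.inner_apply, conj_trivial]
            refine Finset.sum_congr rfl fun a _ => ?_
            simp
            field_simp
  · exfalso
    obtain ⟨f, u, hfp, hfΓ⟩ := geometric_hahn_banach_point_closed (convex_convexHull ℝ _)
      (hΓ.image hΦ).convexHull_of_finiteDimensional.isClosed hp
    let H : Matrix (Fin n) (Fin n) ℝ := Matrix.of fun i j =>
      f (0, Pi.single i (Pi.single j 1))
    have hf2 : ∀ M : Fin n → Fin n → ℝ, f (0, M) = ∑ i, ∑ j, M i j * H i j := by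
      intro M
      have h1 : M = ∑ i, ∑ j, M i j • (Pi.single i (Pi.single j 1) : Fin n → Fin n → ℝ) := by
        ext a b
        simp [Finset.sum_apply, Pi.single_apply, apply_ite, ite_apply]
      have h2 : ((0 : EuclideanSpace ℝ (Fin n)), M) = ∑ i, ∑ j, M i j •
          (((0 : EuclideanSpace ℝ (Fin n)), Pi.single i (Pi.single j 1))) := by
        refine Prod.ext ?_ ?_
        · simp [Prod.fst_sum]
        · simp only [Prod.snd_sum, Prod.smul_snd]; exact h1
      rw [h2, map_sum]
      refine Finset.sum_congr rfl fun i _ => ?_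
      rw [map_sum]
      refine Finset.sum_congr rfl fun j _ => ?_
      rw [map_smul]
      rfl
    let h := (InnerProductSpace.toDual ℝ (EuclideanSpace ℝ (Fin n))).symm
      (f.comp (ContinuousLinearMap.inl ℝ _ _))
    have hf1 : ∀ x, f (x, 0) = inner ℝ h x := fun x => by
      rw [InnerProductSpace.toDual_symm_apply]
      rfl
    have hfp' : f p₀ = H.trace / n := by
      simp only [p₀]
      rw [hf2]
      simp [Matrix.trace, div_eq_inv_mul, Finset.mul_sum]
    rw [hfp'] at hfp
    -- Subtracting μI makes the trace negative; on unit vectors it lowers the quadratic form by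
    -- exactly μ, which stays below the separating level u.
    obtain ⟨μ, hμ1, hμ2⟩ := exists_between hfp
    obtain ⟨A, b, hAb, hdet⟩ := exists_det_gt_one hL.isCompact hL.norm_le h (H - μ • 1)
      (by
        rw [div_lt_iff₀ hn'] at hμ1
        simp [Matrix.trace_sub]
        linarith)
      (fun y hy hy1 => by
        have h1 := hfΓ (Φ y) (subset_convexHull ℝ _ ⟨y, ⟨hy, by simpa using hy1⟩, rfl⟩)
        have h2 : f (Φ y) = inner ℝ h y + ∑ i, ∑ j, y i * y j * H i j := by
          rw [← hf2, ← hf1, ← map_add]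
          exact congrArg f (Prod.ext (by simp [Φ]) (by simp [Φ]))
        have h3 : inner ℝ y ((H - μ • 1).toEuclideanLin y) =
            ∑ i, ∑ j, y i * y j * H i j - μ * ‖y‖ ^ 2 := by
          rw [EuclideanSpace.norm_sq_eq]
          simp only [PiLp.inner_apply, RCLike.inner_apply, conj_trivial,
            Matrix.toLpLin_apply, Matrix.sub_mulVec, Matrix.smul_mulVec, Matrix.one_mulVec]
          simp only [Matrix.mulVec, dotProduct, Pi.sub_apply, Pi.smul_apply, smul_eq_mul, sub_mul,
            Finset.sum_sub_distrib, Finset.sum_mul, Finset.mul_sum]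
          congr 1
          · refine Finset.sum_congr rfl fun i _ => Finset.sum_congr rfl fun j _ => by ring
          · refine Finset.sum_congr rfl fun i _ => by simp; ring
        rw [h3, hy1]
        rw [h2] at h1
        simp at h1 ⊢
        linarith)
    have := hL.abs_det_le A b hAb
    rw [abs_of_pos (by linarith)] at this
    linarith

theorem zero_mem (hL : IsLoewnerPosition L) : (0 : EuclideanSpace ℝ (Fin n)) ∈ L := by
  rcases Nat.eq_zero_or_pos n with rfl | hn
  · obtain ⟨y, hy⟩ := hL.nonempty
    rwa [Subsingleton.elim (0 : EuclideanSpace ℝ (Fin 0)) y]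
  have hn' : (0 : ℝ) < n := by exact_mod_cast hn
  obtain ⟨ι, _, c, x, hc, hcn, hx, -, hx0, -⟩ := hL.exists_decomposition
  have := hL.convex.centerMass_mem (t := Finset.univ) (w := c) (z := x) (fun i _ => hc i)
    (by rw [hcn]; exact hn') (fun i _ => hx i)
  rwa [Finset.centerMass, hx0, smul_zero] at this

/-- If ⟨u, ·⟩ < s on L, then summing c_i(s - ⟨u, x_i⟩)(⟨u, x_i⟩ + ‖u‖) ≥ 0 with John's identities
gives ‖u‖ ≤ ns, so no point of norm at most 1/n can be separated from L. -/
theorem mem_of_norm_le (hL : IsLoewnerPosition L) {z : EuclideanSpace ℝ (Fin n)}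
    (hz : n * ‖z‖ ≤ 1) : z ∈ L := by
  by_contra hzL
  obtain ⟨ι, _, c, x, hc, hcn, hx, hx1, hx0, hxx⟩ := hL.exists_decomposition
  obtain ⟨f, s, hf1, hf2⟩ :=
    geometric_hahn_banach_closed_point hL.convex hL.isCompact.isClosed hzL
  set u := (InnerProductSpace.toDual ℝ (EuclideanSpace ℝ (Fin n))).symm f with hu
  have hfu : ∀ y, f y = inner ℝ u y := fun y => by
    rw [hu, InnerProductSpace.toDual_symm_apply]
  have hs0 : 0 < s := by simpa using hf1 0 hL.zero_mem
  have h0 : ∑ i, c i * inner ℝ u (x i) = 0 := by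
    have : inner ℝ u (∑ i, c i • x i) = 0 := by rw [hx0, inner_zero_right]
    simpa [inner_sum, inner_smul_right] using this
  have hnn : ∀ i, 0 ≤ c i * ((s - inner ℝ u (x i)) * (inner ℝ u (x i) + ‖u‖)) := by
    intro i
    refine mul_nonneg (hc i) (mul_nonneg ?_ ?_)
    · have := hf1 _ (hx i); rw [hfu] at this; linarith
    · have := neg_le_of_abs_le (abs_real_inner_le_norm u (x i)); rw [hx1, mul_one] at this
      linarith
  have hsum : ∑ i, c i * ((s - inner ℝ u (x i)) * (inner ℝ u (x i) + ‖u‖)) =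
      n * s * ‖u‖ - ‖u‖ ^ 2 := by
    have h2 := hxx u u
    rw [real_inner_self_eq_norm_sq] at h2
    simp only [real_inner_comm u] at h2
    calc _ = (s - ‖u‖) * ∑ i, c i * inner ℝ u (x i) + (∑ i, c i) * (s * ‖u‖) -
          ∑ i, c i * (inner ℝ u (x i) * inner ℝ u (x i)) := by
          rw [Finset.mul_sum, Finset.sum_mul, ← Finset.sum_add_distrib, ← Finset.sum_sub_distrib]
          exact Finset.sum_congr rfl fun i _ => by ring
      _ = _ := by rw [h0, hcn, h2]; ring
  have hge := Finset.sum_nonneg (s := Finset.univ) fun i _ => hnn i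
  rw [hsum] at hge
  have hfz : s < ‖u‖ * ‖z‖ := by
    have : s < inner ℝ u z := by rw [← hfu]; simpa using hf2
    exact this.trans_le (real_inner_le_norm u z)
  have hu0 : 0 < ‖u‖ := by
    by_contra h
    have : ‖u‖ = 0 := le_antisymm (not_lt.1 h) (norm_nonneg _)
    rw [this, zero_mul] at hfz
    linarith
  have h1 : ‖u‖ ≤ n * s := by nlinarith
  rcases Nat.eq_zero_or_pos n with rfl | hn
  · rw [Nat.cast_zero, zero_mul] at h1; linarith
  have hn' : (0 : ℝ) < n := by exact_mod_cast hn
  nlinarith [mul_lt_mul_of_pos_left hfz hn']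

end IsLoewnerPosition

/-! ### Grouping and well-conditioned projections. -/

theorem Convex.sum_smul_mem_of_zero_mem {V : Type*} [AddCommGroup V] [Module ℝ V] {C : Set V}
    (hC : Convex ℝ C) (h0 : (0 : V) ∈ C) {ι : Type*} (s : Finset ι) (w : ι → ℝ) (z : ι → V)
    (hw : ∀ i ∈ s, 0 ≤ w i) (hw1 : ∑ i ∈ s, w i ≤ 1) (hz : ∀ i ∈ s, z i ∈ C) :
    ∑ i ∈ s, w i • z i ∈ C := by
  rcases (Finset.sum_nonneg hw).eq_or_lt with h | h
  · have := (Finset.sum_eq_zero_iff_of_nonneg hw).1 h.symm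
    rw [Finset.sum_eq_zero fun i hi => by rw [this i hi, zero_smul]]
    exact h0
  · have h1 := hC.smul_mem_of_zero_mem h0 (hC.centerMass_mem hw h hz) ⟨h.le, hw1⟩
    rwa [Finset.centerMass, smul_inv_smul₀ h.ne'] at h1

theorem Convex.smul_sum_mem_of_zero_mem {V : Type*} [AddCommGroup V] [Module ℝ V] {C : Set V}
    (hC : Convex ℝ C) (h0 : (0 : V) ∈ C) {ι : Type*} (s : Finset ι) {t : ℝ} (z : ι → V)
    (ht : 0 ≤ t) (ht1 : s.card * t ≤ 1) (hz : ∀ i ∈ s, z i ∈ C) :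
    t • ∑ i ∈ s, z i ∈ C := by
  rw [Finset.smul_sum]
  exact hC.sum_smul_mem_of_zero_mem h0 s (fun _ => t) z (fun _ _ => ht) (by simpa using ht1) hz

/-- Weighted Young inequality a² ≤ (M + 1)(a - t)² + (1 + 1/M)t². Each t_l occurs at most M times,
so both coefficients become M + 1. -/
theorem sum_sq_le_of_fibers {k g M : ℕ} (p : Fin k → Fin g)
    (hp : ∀ l, (Finset.univ.filter fun j => p j = l).card ≤ M) (a : Fin k → ℝ) (t : Fin g → ℝ) :
    ∑ j, a j ^ 2 ≤ (M + 1) * (∑ j, (a j - t (p j)) ^ 2 + ∑ l, t l ^ 2) := by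
  rcases Nat.eq_zero_or_pos M with rfl | hM
  · have : IsEmpty (Fin k) := ⟨fun j => by
      have := hp (p j)
      rw [Nat.le_zero, Finset.card_eq_zero] at this
      exact Finset.notMem_empty j (this ▸ Finset.mem_filter.2 ⟨Finset.mem_univ _, rfl⟩)⟩
    simp only [Finset.univ_eq_empty, Finset.sum_empty]
    positivity
  have hM' : (0 : ℝ) < M := by exact_mod_cast hM
  have h1 : ∑ j, t (p j) ^ 2 ≤ M * ∑ l, t l ^ 2 := by
    rw [← Finset.sum_fiberwise Finset.univ p, Finset.mul_sum]
    refine Finset.sum_le_sum fun l _ => ?_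
    rw [Finset.sum_congr rfl fun j hj => by rw [(Finset.mem_filter.1 hj).2], Finset.sum_const,
      nsmul_eq_mul]
    exact mul_le_mul_of_nonneg_right (by exact_mod_cast hp l) (sq_nonneg _)
  have h2 : ∀ j, a j ^ 2 ≤ (M + 1) * (a j - t (p j)) ^ 2 + (1 + 1 / M) * t (p j) ^ 2 := by
    intro j
    have : (M + 1) * (a j - t (p j)) ^ 2 + (1 + 1 / M) * t (p j) ^ 2 - a j ^ 2 =
        (M * (a j - t (p j)) - t (p j)) ^ 2 / M := by
      field_simp; ring
    have h3 : 0 ≤ (M * (a j - t (p j)) - t (p j)) ^ 2 / M := by positivity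
    linarith
  calc ∑ j, a j ^ 2 ≤ ∑ j, ((M + 1) * (a j - t (p j)) ^ 2 + (1 + 1 / M) * t (p j) ^ 2) :=
        Finset.sum_le_sum fun j _ => h2 j
    _ = (M + 1) * ∑ j, (a j - t (p j)) ^ 2 + (1 + 1 / M) * ∑ j, t (p j) ^ 2 := by
        rw [Finset.sum_add_distrib, Finset.mul_sum, Finset.mul_sum]
    _ ≤ (M + 1) * ∑ j, (a j - t (p j)) ^ 2 + (1 + 1 / M) * (M * ∑ l, t l ^ 2) := by gcongr
    _ = _ := by field_simp

section Subspaces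

variable {E : Type*} [NormedAddCommGroup E] [InnerProductSpace ℝ E] [FiniteDimensional ℝ E]

/-- If linear combinations of the `y j` stay away from `H`, there is a subspace orthogonal to `H`
in which the projections of the `y j` form a well-conditioned basis. -/
theorem exists_subspace_of_dist_le {k : ℕ} (y : Fin k → E) (H : Submodule ℝ E) {κ : ℝ}
    (hκ : 0 < κ) (h : ∀ a : Fin k → ℝ, ∀ η ∈ H,
      κ ^ 2 * ∑ j, a j ^ 2 ≤ ‖∑ j, a j • y j - η‖ ^ 2) :
    ∃ (F : Submodule ℝ E) (T : EuclideanSpace ℝ (Fin k) ≃ₗ[ℝ] F), F ≤ Hᗮ ∧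
      Module.finrank ℝ F = k ∧
      (∀ j, T (EuclideanSpace.single j 1) = F.orthogonalProjectionOnto (y j)) ∧
      ∀ a, κ * ‖a‖ ≤ ‖T a‖ := by
  -- The hypothesis at the nearest point η of H is the lower bound for the z_j. On their span F the
  -- projection of y_j is z_j, since y_j - z_j ∈ H is orthogonal to F.
  let z : Fin k → E := fun j => Hᗮ.starProjection (y j)
  have hz : ∀ a : Fin k → ℝ, κ ^ 2 * ∑ j, a j ^ 2 ≤ ‖∑ j, a j • z j‖ ^ 2 := by
    intro a
    have h1 : ∑ j, a j • z j = ∑ j, a j • y j - H.starProjection (∑ j, a j • y j) := by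
      rw [← Submodule.starProjection_orthogonal_val, map_sum]
      simp [z]
    rw [h1]
    exact h a _ (Submodule.starProjection_apply_mem _ _)
  have hli : LinearIndependent ℝ z := by
    rw [Fintype.linearIndependent_iff]
    intro a ha i
    have h1 := hz a
    rw [ha, norm_zero] at h1
    have h2 : ∑ j, a j ^ 2 ≤ 0 := by
      by_contra hcon
      push Not at hcon
      have := mul_pos (pow_pos hκ 2) hcon
      linarith
    have h3 := (Finset.sum_eq_zero_iff_of_nonneg fun j _ => sq_nonneg (a j)).1
      (le_antisymm h2 (Finset.sum_nonneg fun j _ => sq_nonneg (a j))) i (Finset.mem_univ i)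
    exact pow_eq_zero_iff two_ne_zero |>.1 h3
  let F := Submodule.span ℝ (Set.range z)
  let B : Module.Basis (Fin k) ℝ F := Module.Basis.span hli
  let T : EuclideanSpace ℝ (Fin k) ≃ₗ[ℝ] F :=
    (EuclideanSpace.basisFun (Fin k) ℝ).toBasis.equiv B (Equiv.refl _)
  have hFH : F ≤ Hᗮ := by
    rw [Submodule.span_le]
    rintro _ ⟨j, rfl⟩
    exact Submodule.starProjection_apply_mem _ _
  have hT : ∀ j, (T (EuclideanSpace.single j 1) : E) = z j := by
    intro j
    have : EuclideanSpace.single j (1 : ℝ) = (EuclideanSpace.basisFun (Fin k) ℝ).toBasis j := by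
      simp
    rw [this, Module.Basis.equiv_apply]
    exact congrArg Subtype.val (Module.Basis.span_apply hli j)
  refine ⟨F, T, hFH, ?_, fun j => ?_, fun a => ?_⟩
  · rw [Module.finrank_eq_card_basis B, Fintype.card_fin]
  · refine Subtype.ext ?_
    rw [hT, Submodule.coe_orthogonalProjectionOnto_apply]
    refine (Submodule.eq_starProjection_of_mem_orthogonal
      (Submodule.subset_span (Set.mem_range_self j)) ?_).symm
    have : y j - z j ∈ H := by
      simp only [z, Submodule.starProjection_orthogonal_val, sub_sub_cancel]
      exact Submodule.starProjection_apply_mem _ _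
    exact (Submodule.le_orthogonal_iff_le_orthogonal.1 hFH) this
  · have h1 : (T a : E) = ∑ j, a j • z j := by
      have : a = ∑ j, a j • EuclideanSpace.single j (1 : ℝ) := by
        ext i; simp [Pi.single_apply]
      conv_lhs => rw [this, map_sum]
      rw [Submodule.coe_sum]
      refine Finset.sum_congr rfl fun j _ => ?_
      rw [map_smul, Submodule.coe_smul, hT]
    have h2 := hz a
    rw [← h1, ← EuclideanSpace.real_norm_sq_eq, ← mul_pow] at h2
    exact (abs_le_of_sq_le_sq' h2 (norm_nonneg _)).2

/-- Killing the sums over groups of well-conditioned vectors. -/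
theorem exists_subspace_of_groups {k g M : ℕ} (y : Fin k → E) (u : Fin g → E)
    (W : Submodule ℝ E) (p : Fin k → Fin g)
    (hp : ∀ l, (Finset.univ.filter fun j => p j = l).card ≤ M) {κ κ' : ℝ} (hκ' : 0 < κ')
    (hκκ' : κ' ^ 2 * (M + 1) ≤ κ ^ 2)
    (h : ∀ (a : Fin k → ℝ) (b : Fin g → ℝ), κ ^ 2 * (∑ j, a j ^ 2 + ∑ l, b l ^ 2) ≤
      ‖∑ j, a j • Wᗮ.starProjection (y j) + ∑ l, b l • Wᗮ.starProjection (u l)‖ ^ 2) :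
    ∃ (F : Submodule ℝ E) (T : EuclideanSpace ℝ (Fin k) ≃ₗ[ℝ] F), F ≤ Wᗮ ∧
      Module.finrank ℝ F = k ∧
      (∀ j, T (EuclideanSpace.single j 1) = F.orthogonalProjectionOnto (y j)) ∧
      (∀ a, κ' * ‖a‖ ≤ ‖T a‖) ∧
      ∀ l, F.orthogonalProjectionOnto (u l) +
        ∑ j with p j = l, F.orthogonalProjectionOnto (y j) = 0 := by
  let s : Fin g → E := fun l => u l + ∑ j with p j = l, y j
  obtain ⟨F, T, hF, hdim, hT, hTκ⟩ := exists_subspace_of_dist_le y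
    (W ⊔ Submodule.span ℝ (Set.range s)) hκ' (fun a η hη => by
      obtain ⟨w, hw, e, he, rfl⟩ := Submodule.mem_sup.1 hη
      obtain ⟨t, rfl⟩ := (Submodule.mem_span_range_iff_exists_fun ℝ).1 he
      set Q := Wᗮ.starProjection with hQ
      have hQw : Q w = 0 := Submodule.starProjection_orthogonal_apply_eq_zero hw
      -- Modulo W, subtracting group sums shifts the coefficients in group l by t_l and leaves -t_l
      -- on u_l, the shape handled by `sum_sq_le_of_fibers`.
      have h1 : Q (∑ j, a j • y j - (w + ∑ l, t l • s l)) =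
          ∑ j, (a j - t (p j)) • Q (y j) + ∑ l, (-t l) • Q (u l) := by
        have h2 : ∑ l, t l • ∑ j with p j = l, Q (y j) = ∑ j, t (p j) • Q (y j) := by
          rw [← Finset.sum_fiberwise Finset.univ p]
          refine Finset.sum_congr rfl fun l _ => ?_
          rw [Finset.smul_sum]
          refine Finset.sum_congr rfl fun j hj => ?_
          rw [(Finset.mem_filter.1 hj).2]
        simp only [map_sub, map_add, map_sum, map_smul, hQw, zero_add, s, smul_add,
          Finset.sum_add_distrib, h2, sub_smul, Finset.sum_sub_distrib, neg_smul,
          Finset.sum_neg_distrib]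
        abel
      have h3 := h (fun j => a j - t (p j)) (fun l => -t l)
      rw [← h1] at h3
      simp only [neg_sq] at h3
      have h4 : ‖Q (∑ j, a j • y j - (w + ∑ l, t l • s l))‖ ^ 2 ≤
          ‖∑ j, a j • y j - (w + ∑ l, t l • s l)‖ ^ 2 := by
        gcongr
        exact Submodule.norm_starProjection_apply_le _ _
      refine le_trans ?_ (h3.trans h4)
      have h5 := sum_sq_le_of_fibers p hp a t
      have h6 : 0 ≤ ∑ j, (a j - t (p j)) ^ 2 + ∑ l, t l ^ 2 := by positivity
      calc κ' ^ 2 * ∑ j, a j ^ 2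
          ≤ κ' ^ 2 * ((M + 1) * (∑ j, (a j - t (p j)) ^ 2 + ∑ l, t l ^ 2)) := by gcongr
        _ = κ' ^ 2 * (M + 1) * (∑ j, (a j - t (p j)) ^ 2 + ∑ l, t l ^ 2) := by ring
        _ ≤ _ := by gcongr)
  refine ⟨F, T, hF.trans (Submodule.orthogonal_le le_sup_left), hdim, hT, hTκ, fun l => ?_⟩
  rw [← map_sum, ← map_add, Submodule.orthogonalProjectionOnto_eq_zero_iff]
  exact (Submodule.le_orthogonal_iff_le_orthogonal.1 hF)
    (Submodule.mem_sup_right (Submodule.subset_span ⟨l, rfl⟩))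

/-- The trace of an orthogonal projection is its rank; this supplies r in the selection from
projected vectors. -/
theorem sum_norm_sq_starProjection_eq_finrank {ι : Type*} [Fintype ι] {c : ι → ℝ} {x : ι → E}
    (hx : ∀ u w, ∑ i, c i * (inner ℝ u (x i) * inner ℝ (x i) w) = inner ℝ u w)
    (U : Submodule ℝ E) :
    ∑ i, c i * inner ℝ (U.starProjection (x i)) (U.starProjection (x i)) =
      Module.finrank ℝ U := by
  let b := stdOrthonormalBasis ℝ U
  have h1 : ∀ y : E, inner ℝ (U.starProjection y) (U.starProjection y) =
      ∑ m, inner ℝ (b m : E) y * inner ℝ y (b m : E) := by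
    intro y
    rw [Submodule.starProjection_apply, ← Submodule.coe_inner,
      ← b.sum_inner_mul_inner]
    refine Finset.sum_congr rfl fun m _ => ?_
    rw [Submodule.inner_orthogonalProjectionOnto_eq_of_mem_left,
      Submodule.inner_orthogonalProjectionOnto_eq_of_mem_right, mul_comm]
  simp only [h1, Finset.mul_sum]
  rw [Finset.sum_comm]
  simp only [hx]
  have : ∀ m, inner ℝ (b m : E) (b m : E) = (1 : ℝ) := by
    intro m
    rw [← Submodule.coe_inner, real_inner_self_eq_norm_sq, b.norm_eq_one]; norm_num
  simp only [this, Finset.sum_const, Finset.card_univ, Fintype.card_fin, nsmul_eq_mul, mul_one]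

end Subspaces

namespace IsLoewnerPosition

variable {n : ℕ} {L : Set (EuclideanSpace ℝ (Fin n))}

/-- Here ε/4 ≤ 1/n (or n = 0), so -(ε/4)y_j already lies in L and plain selection suffices. -/
theorem exists_subspace_of_mul_le_four (hL : IsLoewnerPosition L) {ε : ℝ} (hε0 : 0 < ε)
    (hε1 : ε < 1) (hn : ε * n ≤ 4) :
    ∃ (k : ℕ) (F : Submodule ℝ (EuclideanSpace ℝ (Fin n))) (T : EuclideanSpace ℝ (Fin k) ≃ₗ[ℝ] F)
      (y : Fin k → EuclideanSpace ℝ (Fin n)),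
      ⌊(1 - ε) * n⌋₊ ≤ k ∧ Module.finrank ℝ F = k ∧ (∀ j, y j ∈ L) ∧ (∀ j, ‖y j‖ = 1) ∧
      (∀ j, T (EuclideanSpace.single j 1) = F.orthogonalProjectionOnto (y j)) ∧
      (∀ a, ε ^ 2 / 16 * ‖a‖ ≤ ‖T a‖) ∧
      ∀ j, -(ε / 4) • F.orthogonalProjectionOnto (y j) ∈ F.orthogonalProjectionOnto '' L := by
  obtain ⟨ι, _, c, x, hc, hcn, hx, hx1, hx0, hxx⟩ := hL.exists_decomposition
  set k := ⌊(1 - ε) * n⌋₊ with hk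
  have hn0 : (0 : ℝ) ≤ n := n.cast_nonneg
  have hkn : (k : ℝ) ≤ (1 - ε) * n := Nat.floor_le (mul_nonneg (by linarith) hn0)
  obtain ⟨σ, hσ⟩ : ∃ σ : Fin k → ι, ∀ a : Fin k → ℝ,
      (ε ^ 2 / 16) ^ 2 * ∑ i, a i ^ 2 ≤ ‖∑ i, a i • x (σ i)‖ ^ 2 := by
    rcases hn0.eq_or_lt with h | h
    · have hk0 : k = 0 := by
        rw [← h] at hkn
        exact_mod_cast le_antisymm (by linarith) (Nat.cast_nonneg (α := ℝ) k)
      have : IsEmpty (Fin k) := by rw [hk0]; infer_instance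
      exact ⟨isEmptyElim, fun a => by simp⟩
    · obtain ⟨σ, hσ⟩ := exists_lower_riesz (v := x) hc h hcn (fun i i' => hxx _ _) (r := n)
        (by simp [hx1, hcn]) le_rfl k (by nlinarith)
      refine ⟨σ, fun a => le_trans (mul_le_mul_of_nonneg_right ?_ (by positivity)) (hσ a)⟩
      have h1 : ε / 2 ≤ (n - k) / (2 * n) := by
        rw [div_le_div_iff₀ two_pos (by positivity)]
        nlinarith
      exact pow_le_pow_left₀ (by positivity) (le_trans (by nlinarith) h1) 2
  obtain ⟨F, T, -, hdim, hT, hTκ⟩ := exists_subspace_of_dist_le (fun j => x (σ j)) ⊥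
    (κ := ε ^ 2 / 16) (by positivity) (fun a η hη => by
      rw [(Submodule.mem_bot ℝ).1 hη, sub_zero]; exact hσ a)
  refine ⟨k, F, T, fun j => x (σ j), le_rfl, hdim, fun j => hx _, fun j => hx1 _, hT, hTκ,
    fun j => ⟨-(ε / 4) • x (σ j), hL.mem_of_norm_le ?_, map_smul _ _ _⟩⟩
  rw [norm_smul, hx1, mul_one, norm_neg, Real.norm_of_nonneg (by positivity)]
  linarith

/-- The grouping argument, with k main and g surplus vectors. The subspace W allows F to be kept
orthogonal to a prescribed translation vector. -/
theorem exists_subspace_of_le_mul (hL : IsLoewnerPosition L) {ε : ℝ} (hε0 : 0 < ε)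
    (hε1 : ε < 1) (W : Submodule ℝ (EuclideanSpace ℝ (Fin n)))
    (hn : 4 * (1 + Module.finrank ℝ W) ≤ ε * n) :
    ∃ (k : ℕ) (F : Submodule ℝ (EuclideanSpace ℝ (Fin n))) (T : EuclideanSpace ℝ (Fin k) ≃ₗ[ℝ] F)
      (y : Fin k → EuclideanSpace ℝ (Fin n)), F ≤ Wᗮ ∧
      ⌊(1 - ε) * n⌋₊ ≤ k ∧ Module.finrank ℝ F = k ∧ (∀ j, y j ∈ L) ∧ (∀ j, ‖y j‖ = 1) ∧
      (∀ j, T (EuclideanSpace.single j 1) = F.orthogonalProjectionOnto (y j)) ∧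
      (∀ a, ε ^ 2 / 16 * ‖a‖ ≤ ‖T a‖) ∧
      ∀ j, -(ε / 4) • F.orthogonalProjectionOnto (y j) ∈ F.orthogonalProjectionOnto '' L := by
  obtain ⟨ι, _, c, x, hc, hcn, hx, hx1, hx0, hxx⟩ := hL.exists_decomposition
  set k := ⌊(1 - ε) * n⌋₊ with hk
  -- The largest group size with εM ≤ 4, so that M points may each carry weight ε/4; it is large
  -- enough that g ≤ εn/4 + 1.
  set M := ⌊4 / ε⌋₊ with hM
  set g := k / M + 1 with hg
  set Q := Wᗮ.starProjection with hQ
  have hW0 : (0 : ℝ) ≤ Module.finrank ℝ W := Nat.cast_nonneg _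
  have hn0 : (0 : ℝ) < n := by
    by_contra h
    push Not at h
    nlinarith
  have hkn : (k : ℝ) ≤ (1 - ε) * n := Nat.floor_le (mul_nonneg (by linarith) hn0.le)
  have h4ε : 4 < 4 / ε := by rw [lt_div_iff₀ hε0]; linarith
  have hMle : (M : ℝ) ≤ 4 / ε := Nat.floor_le (by positivity)
  have hMlt : 4 / ε - 1 < M := by have := Nat.lt_floor_add_one (4 / ε); linarith
  have hM0 : (0 : ℝ) < M := by linarith
  have hMnat : 0 < M := by exact_mod_cast hM0
  have hεM : ε * M ≤ 4 := by rw [le_div_iff₀ hε0] at hMle; linarith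
  have hεM' : 4 - ε ≤ ε * M := by
    have : ε * (4 / ε - 1) = 4 - ε := by field_simp
    nlinarith
  have hgle : (g : ℝ) ≤ ε * n / 4 + 1 := by
    have h1 : ((k / M : ℕ) : ℝ) ≤ k / M := Nat.cast_div_le
    have h2 : (k : ℝ) / M ≤ ε * n / 4 := by
      rw [div_le_iff₀ hM0]
      have : (1 - ε) * n ≤ n * (ε * M) / 4 := by nlinarith
      linarith
    rw [hg]; push_cast; linarith
  have hrank : (Module.finrank ℝ W : ℝ) + Module.finrank ℝ Wᗮ = n := by
    have := W.finrank_add_finrank_orthogonal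
    rw [finrank_euclideanSpace_fin] at this
    exact_mod_cast this
  -- At least 3εn/4 - (1 + dim W) dimensions are left over, and the hypothesis bounds 1 + dim W by
  -- εn/4.
  have hrs : ε * n / 2 ≤ (Module.finrank ℝ Wᗮ : ℝ) - (k + g : ℕ) := by push_cast; nlinarith
  have hQQ : ∀ a b, inner ℝ (Q a) (Q b) = inner ℝ (Q a) b := by
    intro a b
    rw [hQ, ← Submodule.inner_starProjection_left_eq_right,
      Submodule.starProjection_eq_self_iff.2 (Submodule.starProjection_apply_mem _ _)]
  obtain ⟨σ, hσ⟩ := exists_lower_riesz (v := fun i => Q (x i)) hc hn0 hcn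
    (fun i i' => by
      have := hxx (Q (x i)) (Q (x i'))
      rw [← this]
      refine Finset.sum_congr rfl fun j _ => ?_
      have e : inner ℝ (Q (x j)) (Q (x i')) = inner ℝ (x j) (Q (x i')) := by
        rw [real_inner_comm, hQQ, real_inner_comm]
      rw [hQQ, e])
    (sum_norm_sq_starProjection_eq_finrank hxx Wᗮ) (by linarith) (k + g)
    (by nlinarith)
  set κ := (Module.finrank ℝ Wᗮ - (k + g : ℕ) : ℝ) / (2 * n) with hκdef
  have hκ : ε / 4 ≤ κ := by
    rw [hκdef, div_le_div_iff₀ (by norm_num) (by positivity)]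
    linarith
  -- Since M + 1 ≤ 5/ε, the left side is at most 5ε³/256, below (ε/4)².
  have hκκ : (ε ^ 2 / 16) ^ 2 * (M + 1) ≤ κ ^ 2 := by
    calc (ε ^ 2 / 16) ^ 2 * (M + 1) = ε ^ 3 / 256 * (ε * M + ε) := by ring
      _ ≤ ε ^ 3 / 256 * 5 := by gcongr; linarith
      _ ≤ (ε / 4) ^ 2 := by nlinarith [sq_nonneg ε, pow_pos hε0 2]
      _ ≤ κ ^ 2 := by gcongr
  let p : Fin k → Fin g := fun j => ⟨j / M, Nat.lt_succ_of_le (Nat.div_le_div_right j.2.le)⟩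
  have hp : ∀ l, (Finset.univ.filter fun j => p j = l).card ≤ M := by
    intro l
    calc _ ≤ (Finset.range M).card := by
          refine Finset.card_le_card_of_injOn (fun j => (j : ℕ) % M)
            (fun j _ => by simpa using Nat.mod_lt _ hMnat) fun i hi j hj hij => ?_
          have hi' : (i : ℕ) / M = l := congrArg Fin.val (Finset.mem_filter.1 hi).2
          have hj' : (j : ℕ) / M = l := congrArg Fin.val (Finset.mem_filter.1 hj).2
          refine Fin.ext ?_
          rw [← Nat.div_add_mod (i : ℕ) M, ← Nat.div_add_mod (j : ℕ) M, hi', hj']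
          exact congrArg _ hij
      _ = M := Finset.card_range M
  set y : Fin k → EuclideanSpace ℝ (Fin n) := fun j => x (σ (Fin.castAdd g j)) with hy
  set u : Fin g → EuclideanSpace ℝ (Fin n) := fun l => x (σ (Fin.natAdd k l)) with hu
  obtain ⟨F, T, hF, hdim, hT, hTκ, hsum⟩ := exists_subspace_of_groups y u W p hp (κ := κ)
    (κ' := ε ^ 2 / 16) (by positivity) hκκ (fun a b => by
      have := hσ (Fin.append a b)
      simpa only [Fin.sum_univ_add, Fin.append_left, Fin.append_right] using this)
  refine ⟨k, F, T, y, hF, le_rfl, hdim, fun j => hx _, fun j => hx1 _, hT, hTκ, fun j => ?_⟩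
  have hconv : Convex ℝ (F.orthogonalProjectionOnto '' L) :=
    hL.convex.linear_image F.orthogonalProjectionOnto.toLinearMap
  have h0 : (0 : F) ∈ F.orthogonalProjectionOnto '' L := ⟨0, hL.zero_mem, map_zero _⟩
  set S := (Finset.univ.filter fun i => p i = p j).erase j with hS
  have hjmem : j ∈ Finset.univ.filter fun i => p i = p j := by simp
  -- `none` stands for the surplus vector of the group. Removing j and adding it keeps the number of
  -- summands at most M.
  have hneg : -F.orthogonalProjectionOnto (y j) = ∑ o ∈ Finset.insertNone S,
      F.orthogonalProjectionOnto (o.elim (u (p j)) y) := by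
    rw [Finset.sum_insertNone]
    have := hsum (p j)
    rw [← Finset.add_sum_erase _ _ hjmem] at this
    rw [neg_eq_iff_add_eq_zero, ← this]
    simp only [Option.elim]
    abel
  rw [neg_smul, ← smul_neg, hneg]
  refine hconv.smul_sum_mem_of_zero_mem h0 _ _ (by positivity) ?_ fun o _ => ?_
  · have : (Finset.insertNone S).card ≤ M := by
      rw [Finset.card_insertNone, hS, Finset.card_erase_add_one hjmem]
      exact hp _
    have : ((Finset.insertNone S).card : ℝ) ≤ M := by exact_mod_cast this
    nlinarith
  · refine ⟨_, ?_, rfl⟩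
    cases o
    · exact hx _
    · exact hx _

theorem exists_subspace (hL : IsLoewnerPosition L) {ε : ℝ} (hε0 : 0 < ε) (hε1 : ε < 1) :
    ∃ (k : ℕ) (F : Submodule ℝ (EuclideanSpace ℝ (Fin n))) (T : EuclideanSpace ℝ (Fin k) ≃ₗ[ℝ] F)
      (y : Fin k → EuclideanSpace ℝ (Fin n)),
      ⌊(1 - ε) * n⌋₊ ≤ k ∧ Module.finrank ℝ F = k ∧ (∀ j, y j ∈ L) ∧ (∀ j, ‖y j‖ = 1) ∧
      (∀ j, T (EuclideanSpace.single j 1) = F.orthogonalProjectionOnto (y j)) ∧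
      (∀ a, ε ^ 2 / 16 * ‖a‖ ≤ ‖T a‖) ∧
      ∀ j, -(ε / 4) • F.orthogonalProjectionOnto (y j) ∈ F.orthogonalProjectionOnto '' L := by
  rcases le_total (ε * n) 4 with h | h
  · exact hL.exists_subspace_of_mul_le_four hε0 hε1 h
  · obtain ⟨k, F, T, y, -, h⟩ := hL.exists_subspace_of_le_mul hε0 hε1 ⊥ (by simpa using h)
    exact ⟨k, F, T, y, h⟩

end IsLoewnerPosition

/-! ### Distance estimates from ball inclusions. -/

section BanachMazur

variable {V : Type*} [AddCommGroup V] [Module ℝ V] {k : ℕ}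

theorem banachMazurDist_le {C : Set V} {L : Set (EuclideanSpace ℝ (Fin k))}
    (T : EuclideanSpace ℝ (Fin k) ≃ₗ[ℝ] V) {α β : ℝ} (hα : 0 < α) (hβ : 0 < β)
    (h1 : β • (T '' L) ⊆ C) (h2 : C ⊆ α • (T '' L)) :
    banachMazurDist C L ≤ ENNReal.ofReal (α / β) := by
  refine iInf_le_of_le T.symm (iInf_le_of_le α (iInf_le_of_le β (iInf_le_of_le hα
    (iInf_le_of_le hβ (iInf_le_of_le ⟨?_, ?_⟩ le_rfl)))))
  · rintro _ ⟨l, hl, rfl⟩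
    exact ⟨β • T l, h1 ⟨T l, ⟨l, hl, rfl⟩, rfl⟩, by simp⟩
  · rintro _ ⟨x, hx, rfl⟩
    obtain ⟨_, ⟨l, hl, rfl⟩, rfl⟩ := h2 hx
    exact ⟨l, hl, by simp⟩

/-- Admissible dilations must be positive, whereas √n vanishes for n = 0; the bounds are proved for
every m > √n and passed to the limit. -/
theorem ENNReal.le_ofReal_mul_of_forall_gt {d : ℝ≥0∞} {m₀ c : ℝ}
    (h : ∀ m > m₀, d ≤ ENNReal.ofReal (m * c)) : d ≤ ENNReal.ofReal (m₀ * c) := by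
  have hc : Continuous fun m : ℝ => ENNReal.ofReal (m * c) :=
    ENNReal.continuous_ofReal.comp (by fun_prop)
  exact ge_of_tendsto ((hc.tendsto m₀).mono_left nhdsWithin_le_nhds)
    (Filter.eventually_of_mem self_mem_nhdsWithin h : ∀ᶠ m in nhdsWithin m₀ (Set.Ioi m₀), _)

theorem sum_abs_le_sqrt_mul_norm (a : EuclideanSpace ℝ (Fin k)) : ∑ i, |a i| ≤ √k * ‖a‖ := by
  have h := Finset.sum_mul_sq_le_sq_mul_sq Finset.univ (fun _ : Fin k => (1 : ℝ)) fun i => |a i|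
  simp only [one_mul, one_pow, sq_abs, Finset.sum_const, Finset.card_univ, Fintype.card_fin,
    nsmul_eq_mul, mul_one] at h
  rw [← EuclideanSpace.real_norm_sq_eq] at h
  refine (abs_le_of_sq_le_sq' ?_ (by positivity)).2
  rw [mul_pow, Real.sq_sqrt (Nat.cast_nonneg _)]
  exact h

theorem norm_le_sqrt_of_mem_unitBallInf {a : EuclideanSpace ℝ (Fin k)} (ha : a ∈ unitBallInf k) :
    ‖a‖ ≤ √k := by
  refine Real.le_sqrt_of_sq_le ?_
  rw [EuclideanSpace.real_norm_sq_eq]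
  calc ∑ i, a i ^ 2 ≤ ∑ _i : Fin k, (1 : ℝ) :=
        Finset.sum_le_sum fun i _ => by rw [← sq_abs]; exact pow_le_one₀ (abs_nonneg _) (ha i)
    _ = k := by simp

theorem banachMazurDist_unitBallOne_le {C : Set V} (T : EuclideanSpace ℝ (Fin k) ≃ₗ[ℝ] V)
    {n : ℕ} (hkn : k ≤ n) {α β : ℝ} (hα : 0 < α) (hβ : 0 < β)
    (h1 : β • (T '' unitBallOne k) ⊆ C) (h2 : C ⊆ α • (T '' unitBallTwo k)) :
    banachMazurDist C (unitBallOne k) ≤ ENNReal.ofReal (√n * (α / β)) := by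
  refine ENNReal.le_ofReal_mul_of_forall_gt fun m hm => ?_
  have hm0 : 0 < m := (Real.sqrt_nonneg _).trans_lt hm
  have hkm : √k ≤ m := (Real.sqrt_le_sqrt (by exact_mod_cast hkn)).trans hm.le
  rw [← mul_div_assoc]
  refine banachMazurDist_le T (mul_pos hm0 hα) hβ h1 fun x hx => ?_
  obtain ⟨_, ⟨a, ha, rfl⟩, rfl⟩ := h2 hx
  refine ⟨T (m⁻¹ • a), ⟨_, ?_, rfl⟩, ?_⟩
  · have ha1 : ‖a‖ ≤ 1 := by simpa [unitBallTwo] using ha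
    have h3 : ∑ i, |a i| ≤ m := (sum_abs_le_sqrt_mul_norm a).trans
      ((mul_le_of_le_one_right (Real.sqrt_nonneg _) ha1).trans hkm)
    simp only [unitBallOne, Set.mem_ofPred_eq, PiLp.smul_apply, smul_eq_mul, abs_mul,
      ← Finset.mul_sum, abs_of_pos (inv_pos.2 hm0)]
    rw [inv_mul_le_iff₀ hm0, mul_one]
    exact h3
  · simp only [map_smul, smul_smul]
    congr 1
    field_simp

theorem banachMazurDist_unitBallInf_le {C : Set V} (T : EuclideanSpace ℝ (Fin k) ≃ₗ[ℝ] V)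
    {n : ℕ} (hkn : k ≤ n) {α β : ℝ} (hα : 0 < α) (hβ : 0 < β)
    (h1 : β • (T '' unitBallTwo k) ⊆ C) (h2 : C ⊆ α • (T '' unitBallInf k)) :
    banachMazurDist C (unitBallInf k) ≤ ENNReal.ofReal (√n * (α / β)) := by
  refine ENNReal.le_ofReal_mul_of_forall_gt fun m hm => ?_
  have hm0 : 0 < m := (Real.sqrt_nonneg _).trans_lt hm
  have hkm : √k ≤ m := (Real.sqrt_le_sqrt (by exact_mod_cast hkn)).trans hm.le
  have : m * (α / β) = α / (β / m) := by field_simp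
  rw [this]
  refine banachMazurDist_le T hα (div_pos hβ hm0) ?_ h2
  rintro _ ⟨_, ⟨a, ha, rfl⟩, rfl⟩
  refine h1 ⟨T (m⁻¹ • a), ⟨_, ?_, rfl⟩, ?_⟩
  · rw [unitBallTwo, mem_closedBall_zero_iff, norm_smul, Real.norm_of_nonneg (by positivity),
      inv_mul_le_iff₀ hm0, mul_one]
    exact (norm_le_sqrt_of_mem_unitBallInf ha).trans hkm
  · simp only [map_smul, smul_smul]
    congr 1

theorem Convex.smul_image_unitBallOne_subset {C : Set V} (hC : Convex ℝ C) (h0 : (0 : V) ∈ C)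
    (T : EuclideanSpace ℝ (Fin k) ≃ₗ[ℝ] V) {t : ℝ}
    (h1 : ∀ j, t • T (EuclideanSpace.single j 1) ∈ C)
    (h2 : ∀ j, -t • T (EuclideanSpace.single j 1) ∈ C) :
    t • (T '' unitBallOne k) ⊆ C := by
  rintro _ ⟨_, ⟨a, ha, rfl⟩, rfl⟩
  have h3 : t • T a = ∑ j, |a j| •
      (if 0 ≤ a j then t • T (EuclideanSpace.single j 1)
        else -t • T (EuclideanSpace.single j 1)) := by
    have : a = ∑ j, a j • EuclideanSpace.single j (1 : ℝ) := by
      ext i; simp [Pi.single_apply]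
    conv_lhs => rw [this, map_sum, Finset.smul_sum]
    refine Finset.sum_congr rfl fun j _ => ?_
    rw [map_smul]
    split_ifs with h
    · rw [abs_of_nonneg h, smul_comm]
    · rw [abs_of_neg (not_le.1 h), smul_comm, neg_smul, neg_smul, smul_neg, neg_neg]
  simp only [h3]
  refine hC.sum_smul_mem_of_zero_mem h0 _ _ _ (fun j _ => abs_nonneg _) ha fun j _ => ?_
  split_ifs
  · exact h1 j
  · exact h2 j

end BanachMazur

/-! ### Polars and contact points. -/

section Polar

/-- The polar set `{z | ⟪z, x⟫ ≤ 1 for all x ∈ K}` (without absolute value). -/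
def polarBody {n : ℕ} (K : Set (EuclideanSpace ℝ (Fin n))) : Set (EuclideanSpace ℝ (Fin n)) :=
  {z | ∀ x ∈ K, inner ℝ z x ≤ 1}

variable {n : ℕ} {K : Set (EuclideanSpace ℝ (Fin n))}

theorem isClosed_polarBody : IsClosed (polarBody K) := by
  have : polarBody K = ⋂ x ∈ K, {z | inner ℝ z x ≤ 1} := by ext; simp [polarBody]
  rw [this]
  exact isClosed_biInter fun x _ => isClosed_le (by fun_prop) continuous_const

theorem convex_polarBody : Convex ℝ (polarBody K) := by
  intro z hz w hw a b ha hb hab x hx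
  rw [inner_add_left, real_inner_smul_left, real_inner_smul_left]
  nlinarith [hz x hx, hw x hx]

theorem zero_mem_polarBody : (0 : EuclideanSpace ℝ (Fin n)) ∈ polarBody K :=
  fun x _ => by simp

theorem norm_le_of_mem_polarBody {r : ℝ} (hr : 0 < r) (hK : ∀ x, ‖x‖ ≤ r → x ∈ K)
    {z : EuclideanSpace ℝ (Fin n)} (hz : z ∈ polarBody K) : ‖z‖ ≤ 1 / r := by
  rcases eq_or_ne z 0 with rfl | h
  · simp [hr.le]
  have hz0 : 0 < ‖z‖ := norm_pos_iff.2 h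
  have h1 := hz ((r / ‖z‖) • z) (hK _ (by
    rw [norm_smul, Real.norm_of_nonneg (by positivity), div_mul_cancel₀ _ hz0.ne']))
  rw [real_inner_smul_right, real_inner_self_eq_norm_sq] at h1
  rw [le_div_iff₀ hr]
  calc ‖z‖ * r = r / ‖z‖ * ‖z‖ ^ 2 := by field_simp
    _ ≤ 1 := h1

theorem mem_iff_forall_polarBody (hK : Convex ℝ K) (hKc : IsClosed K)
    (h0 : (0 : EuclideanSpace ℝ (Fin n)) ∈ K) {x : EuclideanSpace ℝ (Fin n)} :
    x ∈ K ↔ ∀ z ∈ polarBody K, inner ℝ x z ≤ 1 := by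
  refine ⟨fun hx z hz => by rw [real_inner_comm]; exact hz x hx, fun h => ?_⟩
  by_contra hx
  obtain ⟨f, s, hf1, hf2⟩ := geometric_hahn_banach_closed_point hK hKc hx
  have hs0 : 0 < s := by simpa using hf1 0 h0
  set u := (InnerProductSpace.toDual ℝ (EuclideanSpace ℝ (Fin n))).symm f with hu
  have hfu : ∀ y, f y = inner ℝ u y := fun y => by
    rw [hu, InnerProductSpace.toDual_symm_apply]
  have h1 := h (s⁻¹ • u) fun y hy => by
    rw [real_inner_smul_left, ← hfu, inv_mul_le_iff₀ hs0, mul_one]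
    exact (hf1 y hy).le
  rw [real_inner_smul_right, real_inner_comm, ← hfu, inv_mul_le_iff₀ hs0, mul_one] at h1
  linarith

/-- For t > 1 the point tx violates the half-space bound, so x is not interior. -/
theorem mem_contactPoints {x : EuclideanSpace ℝ (Fin n)} (hx : x ∈ K) (hx1 : ‖x‖ = 1)
    (h : ∀ y ∈ K, inner ℝ x y ≤ 1) : x ∈ contactPoints K := by
  refine ⟨⟨subset_closure hx, fun hint => ?_⟩, by simpa using hx1⟩
  rw [mem_interior_iff_mem_nhds] at hint
  have hc : Filter.Tendsto (fun t : ℝ => t • x) (nhdsWithin 1 (Set.Ioi 1)) (nhds x) := by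
    have : Continuous fun t : ℝ => t • x := by fun_prop
    simpa using (this.tendsto 1).mono_left nhdsWithin_le_nhds
  obtain ⟨t, ht, ht1⟩ := ((hc.eventually hint).and self_mem_nhdsWithin).exists
  have := h _ ht
  rw [real_inner_smul_right, real_inner_self_eq_norm_sq, hx1] at this
  linarith

end Polar

/-! ### From extremal ellipsoids to Löwner position. -/

section Volume

variable {n : ℕ} {K : Set (EuclideanSpace ℝ (Fin n))}

/-- Ellipsoids given by an invertible linear map and a translation, with their volume. -/
theorem isEllipsoid_image_translate (G : EuclideanSpace ℝ (Fin n) ≃ₗ[ℝ] EuclideanSpace ℝ (Fin n))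
    (b : EuclideanSpace ℝ (Fin n)) :
    IsEllipsoid (G '' ((fun u => u + b) '' Metric.closedBall 0 1)) ∧
    MeasureTheory.volume (G '' ((fun u => u + b) '' Metric.closedBall 0 1)) =
      ENNReal.ofReal |LinearMap.det (G : EuclideanSpace ℝ (Fin n) →ₗ[ℝ] EuclideanSpace ℝ (Fin n))| *
        MeasureTheory.volume (unitBallTwo n) := by
  constructor
  · refine ⟨(AffineEquiv.constVAdd ℝ _ b).trans G.toAffineEquiv, ?_⟩
    rw [Set.image_image]
    refine Set.image_congr fun u _ => ?_
    simp [add_comm]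
  · have := MeasureTheory.Measure.addHaar_image_linearMap MeasureTheory.volume
      (G : EuclideanSpace ℝ (Fin n) →ₗ[ℝ] EuclideanSpace ℝ (Fin n))
      ((fun u => u + b) '' Metric.closedBall 0 1)
    rw [Set.image_add_right, MeasureTheory.measure_preimage_add_right] at this
    rw [Set.image_add_right]
    exact this

theorem one_le_of_volume_unitBallTwo_le {d : ℝ} (h : MeasureTheory.volume (unitBallTwo n) ≤
    ENNReal.ofReal d * MeasureTheory.volume (unitBallTwo n)) : 1 ≤ d := by
  have h0 : MeasureTheory.volume (unitBallTwo n) ≠ 0 :=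
    (Metric.measure_closedBall_pos _ _ one_pos).ne'
  have ht : MeasureTheory.volume (unitBallTwo n) ≠ ∞ :=
    (isCompact_closedBall _ _).measure_lt_top.ne
  by_contra hd
  have h1 : ENNReal.ofReal d < 1 := by rw [ENNReal.ofReal_lt_one]; exact not_le.1 hd
  have := ENNReal.mul_lt_mul_left h0 ht h1
  rw [one_mul] at this
  exact absurd h (not_le.2 this)

theorem le_one_of_mul_volume_unitBallTwo_le {d : ℝ} (h : ENNReal.ofReal d *
    MeasureTheory.volume (unitBallTwo n) ≤ MeasureTheory.volume (unitBallTwo n)) : d ≤ 1 := by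
  have h0 : MeasureTheory.volume (unitBallTwo n) ≠ 0 :=
    (Metric.measure_closedBall_pos _ _ one_pos).ne'
  have ht : MeasureTheory.volume (unitBallTwo n) ≠ ∞ :=
    (isCompact_closedBall _ _).measure_lt_top.ne
  by_contra hd
  have h1 : 1 < ENNReal.ofReal d := by rw [ENNReal.one_lt_ofReal]; exact not_le.1 hd
  have := ENNReal.mul_lt_mul_left h0 ht h1
  rw [one_mul] at this
  exact absurd h (not_le.2 this)

/-- If y ↦ Ay - b is invertible and maps K into the unit ball B, then A⁻¹(B + b) is an ellipsoid
around K whose volume is that of B divided by |det A|. -/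
theorem IsMinVolumeEllipsoid.isLoewnerPosition (hKc : IsCompact K) (hK : Convex ℝ K)
    (hne : K.Nonempty) (h : IsMinVolumeEllipsoid (unitBallTwo n) K) : IsLoewnerPosition K where
  isCompact := hKc
  convex := hK
  nonempty := hne
  norm_le y hy := by simpa [unitBallTwo] using h.2.1 hy
  abs_det_le A b hAb := by
    by_cases hA : LinearMap.det A = 0
    · rw [hA, abs_zero]; exact zero_le_one
    let e := A.equivOfDetNeZero hA
    have he : ∀ x, e x = A x := fun x => rfl
    obtain ⟨h1, h2⟩ := isEllipsoid_image_translate e.symm b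
    have h3 := h.2.2 _ h1 fun y hy => by
      refine ⟨A y, ⟨A y - b, by simpa using hAb y hy, by simp⟩, ?_⟩
      rw [← he, e.symm_apply_apply]
    rw [h2] at h3
    have h4 := one_le_of_volume_unitBallTwo_le h3
    have h5 := LinearEquiv.det_mul_det_symm e
    have h6 : LinearMap.det (e : EuclideanSpace ℝ (Fin n) →ₗ[ℝ] EuclideanSpace ℝ (Fin n)) =
      LinearMap.det A := rfl
    rw [h6] at h5
    have h7 := congrArg abs h5
    rw [abs_mul, abs_one] at h7
    nlinarith [abs_nonneg (LinearMap.det A)]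

theorem LinearMap.det_adjoint_real
    (A : EuclideanSpace ℝ (Fin n) →ₗ[ℝ] EuclideanSpace ℝ (Fin n)) :
    LinearMap.det (LinearMap.adjoint A) = LinearMap.det A := by
  let b := EuclideanSpace.basisFun (Fin n) ℝ
  rw [← LinearMap.det_toMatrix b.toBasis, LinearMap.toMatrix_adjoint b b, Matrix.det_conjTranspose,
    LinearMap.det_toMatrix, star_trivial]

/-- With τ = ⟨v, b⟩ - ‖b‖² one has 1 - τ ≥ 0 and (1 - τ)² - ‖v - b‖² ≥ τ² + ‖b‖². This is what
handles ellipsoids with arbitrary centre under polarity. -/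
theorem norm_sub_add_inner_le {v b : EuclideanSpace ℝ (Fin n)} (hv : ‖v‖ ≤ 1) :
    ‖v - b‖ + inner ℝ (v - b) b ≤ 1 := by
  rw [inner_sub_left, real_inner_self_eq_norm_sq]
  have ht : inner ℝ v b ≤ ‖b‖ := (real_inner_le_norm v b).trans
    (mul_le_of_le_one_left (norm_nonneg _) hv)
  have h1 := norm_sub_sq_real v b
  have h2 : 0 ≤ 1 - inner ℝ v b + ‖b‖ ^ 2 := by nlinarith [sq_nonneg (‖b‖ - 1 / 2)]
  have h3 : ‖v - b‖ ≤ 1 - inner ℝ v b + ‖b‖ ^ 2 := by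
    refine (abs_le_of_sq_le_sq' ?_ h2).2
    have : ‖v‖ ^ 2 ≤ 1 := pow_le_one₀ (norm_nonneg _) hv
    nlinarith [sq_nonneg (inner ℝ v b - ‖b‖ ^ 2), sq_nonneg ‖b‖]
  linarith

/-- If z ↦ Az - b maps the polar into the unit ball B, then A*(B - b) ⊆ K, because ⟨A*(v - b), z⟩ =
⟨v - b, Az - b⟩ + ⟨v - b, b⟩ ≤ ‖v - b‖ + ⟨v - b, b⟩ ≤ 1. Maximality of B then bounds |det A|. -/
theorem IsMaxVolumeEllipsoid.isLoewnerPosition_polarBody (hKc : IsCompact K) (hK : Convex ℝ K)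
    (h : IsMaxVolumeEllipsoid (unitBallTwo n) K) : IsLoewnerPosition (polarBody K) := by
  have hball : ∀ x, ‖x‖ ≤ 1 → x ∈ K := fun x hx => h.2.1 (by simpa [unitBallTwo] using hx)
  have hnorm : ∀ z ∈ polarBody K, ‖z‖ ≤ 1 := fun z hz => by
    simpa using norm_le_of_mem_polarBody one_pos hball hz
  refine ⟨?_, convex_polarBody, ⟨0, zero_mem_polarBody⟩, hnorm, fun A b hAb => ?_⟩
  · exact (isCompact_closedBall (0 : EuclideanSpace ℝ (Fin n)) 1).of_isClosed_subset
      isClosed_polarBody fun z hz => by simpa using hnorm z hz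
  · by_cases hA : LinearMap.det A = 0
    · rw [hA, abs_zero]; exact zero_le_one
    rw [← LinearMap.det_adjoint_real] at hA ⊢
    let e := (LinearMap.adjoint A).equivOfDetNeZero hA
    have he : ∀ x, e x = LinearMap.adjoint A x := fun x => rfl
    obtain ⟨h1, h2⟩ := isEllipsoid_image_translate e (-b)
    have h3 := h.2.2 _ h1 (by
      rintro _ ⟨_, ⟨v, hv, rfl⟩, rfl⟩
      rw [mem_iff_forall_polarBody hK hKc.isClosed (hball 0 (by simp))]
      intro z hz
      have hv' : ‖v‖ ≤ 1 := by simpa using hv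
      rw [he, LinearMap.adjoint_inner_left]
      have h4 : inner ℝ (v + -b) (A z) = inner ℝ (v - b) (A z - b) + inner ℝ (v - b) b := by
        rw [← inner_add_right, sub_add_cancel, sub_eq_add_neg]
      rw [h4]
      have h5 : inner ℝ (v - b) (A z - b) ≤ ‖v - b‖ :=
        (real_inner_le_norm _ _).trans (mul_le_of_le_one_right (norm_nonneg _) (hAb z hz))
      linarith [norm_sub_add_inner_le (b := b) hv'])
    rw [h2] at h3
    exact le_one_of_mul_volume_unitBallTwo_le h3

end Volume

/-! ### Sections by duality. -/

section Sections

variable {n : ℕ}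

/-- Dualizing a well-conditioned basis of projections to coordinates on a section. -/
theorem exists_section_of_projection {K L : Set (EuclideanSpace ℝ (Fin n))}
    (hL : ∀ z ∈ L, ‖z‖ ≤ 1)
    (G : EuclideanSpace ℝ (Fin n) ≃ₗ[ℝ] EuclideanSpace ℝ (Fin n)) {ε : ℝ} (hε0 : 0 < ε)
    (hε1 : ε < 1) {k : ℕ} (F : Submodule ℝ (EuclideanSpace ℝ (Fin n)))
    (T : EuclideanSpace ℝ (Fin k) ≃ₗ[ℝ] F) (y : Fin k → EuclideanSpace ℝ (Fin n))
    (hdim : Module.finrank ℝ F = k) (hy : ∀ j, y j ∈ L)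
    (hT : ∀ j, T (EuclideanSpace.single j 1) = F.orthogonalProjectionOnto (y j))
    (hTκ : ∀ a, ε ^ 2 / 16 * ‖a‖ ≤ ‖T a‖)
    (hneg : ∀ j, -(ε / 4) • F.orthogonalProjectionOnto (y j) ∈ F.orthogonalProjectionOnto '' L)
    (hG : ∀ f ∈ F, G f ∈ K ↔ ∀ z ∈ L, inner ℝ f z ≤ 1) :
    ∃ (F' : Submodule ℝ (EuclideanSpace ℝ (Fin n))) (S : EuclideanSpace ℝ (Fin k) ≃ₗ[ℝ] F'),
      Module.finrank ℝ F' = k ∧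
      (∀ (a : EuclideanSpace ℝ (Fin k)) (j : Fin k), inner ℝ (G.symm (S a)) (y j) = a j) ∧
      (ε ^ 2 / 16) • (S '' unitBallTwo k) ⊆ ((↑) : F' → EuclideanSpace ℝ (Fin n)) ⁻¹' K ∧
      ((↑) : F' → EuclideanSpace ℝ (Fin n)) ⁻¹' K ⊆ (4 / ε) • (S '' unitBallInf k) ∧
      banachMazurDist (((↑) : F' → EuclideanSpace ℝ (Fin n)) ⁻¹' K) (unitBallInf k) ≤
        ENNReal.ofReal (64 * √(n : ℝ) / ε ^ 3) := by
  set κ := ε ^ 2 / 16 with hκ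
  have hκ0 : 0 < κ := by positivity
  let Tl : EuclideanSpace ℝ (Fin k) →ₗ[ℝ] F := T
  have hinj : Function.Injective (LinearMap.adjoint Tl) := by
    rw [injective_iff_map_eq_zero]
    intro f hf
    have h1 : inner ℝ (T.symm f) (LinearMap.adjoint Tl f) = inner ℝ f f := by
      rw [LinearMap.adjoint_inner_right]
      simp [Tl]
    rw [hf, inner_zero_right] at h1
    exact inner_self_eq_zero.1 h1.symm
  -- The adjoint of T: its coordinates are the pairings ⟨f, y_j⟩, and it inherits the lower bound of
  -- T.
  let U : F ≃ₗ[ℝ] EuclideanSpace ℝ (Fin k) :=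
    LinearEquiv.ofInjectiveOfFinrankEq (LinearMap.adjoint Tl) hinj (by
      rw [hdim, finrank_euclideanSpace_fin])
  have hU : ∀ f, U f = LinearMap.adjoint Tl f := fun f => rfl
  have hUy : ∀ (f : F) j, inner ℝ (f : EuclideanSpace ℝ (Fin n)) (y j) = U f j := by
    intro f j
    have h1 : U f j = inner ℝ (EuclideanSpace.single j (1 : ℝ)) (U f) := by
      rw [EuclideanSpace.inner_single_left]; simp
    rw [h1, hU, LinearMap.adjoint_inner_right]
    simp only [Tl, LinearEquiv.coe_coe]
    rw [hT, real_inner_comm, Submodule.inner_orthogonalProjectionOnto_eq_of_mem_right]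
  have hUκ : ∀ f, κ * ‖f‖ ≤ ‖U f‖ := by
    intro f
    rcases eq_or_ne f 0 with rfl | hf
    · simp
    have hf0 : 0 < ‖f‖ := norm_pos_iff.2 hf
    have h1 : ‖f‖ ^ 2 = inner ℝ (T.symm f) (U f) := by
      rw [hU, LinearMap.adjoint_inner_right, ← real_inner_self_eq_norm_sq]
      simp [Tl]
    have h2 := real_inner_le_norm (T.symm f) (U f)
    have h3 := hTκ (T.symm f)
    rw [T.apply_symm_apply] at h3
    rw [← h1] at h2
    have h4 : κ * ‖f‖ ^ 2 ≤ ‖f‖ * ‖U f‖ := by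
      calc κ * ‖f‖ ^ 2 ≤ κ * (‖T.symm f‖ * ‖U f‖) := by gcongr
        _ = κ * ‖T.symm f‖ * ‖U f‖ := by ring
        _ ≤ _ := by gcongr
    nlinarith
  let S : EuclideanSpace ℝ (Fin k) ≃ₗ[ℝ] F.map (G : _ →ₗ[ℝ] EuclideanSpace ℝ (Fin n)) :=
    U.symm.trans (G.submoduleMap F)
  have hS : ∀ a, (S a : EuclideanSpace ℝ (Fin n)) = G (U.symm a) := fun a => rfl
  have h1 : κ • (S '' unitBallTwo k) ⊆
      ((↑) : F.map (G : _ →ₗ[ℝ] EuclideanSpace ℝ (Fin n)) → EuclideanSpace ℝ (Fin n)) ⁻¹' K := by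
    rintro _ ⟨_, ⟨a, ha, rfl⟩, rfl⟩
    have ha1 : ‖a‖ ≤ 1 := by simpa [unitBallTwo] using ha
    have : ((κ • S a : F.map (G : _ →ₗ[ℝ] EuclideanSpace ℝ (Fin n))) : EuclideanSpace ℝ (Fin n)) =
        G ((κ • U.symm a : F) : EuclideanSpace ℝ (Fin n)) := by
      rw [Submodule.coe_smul, hS, Submodule.coe_smul, map_smul]
    rw [Set.mem_preimage]
    simp only [this]
    rw [hG _ (Submodule.coe_mem _)]
    intro z hz
    have h2 := hUκ (U.symm a)
    rw [U.apply_symm_apply] at h2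
    have h3 : ‖((κ • U.symm a : F) : EuclideanSpace ℝ (Fin n))‖ ≤ 1 := by
      change ‖κ • U.symm a‖ ≤ 1
      rw [norm_smul, Real.norm_of_nonneg hκ0.le]
      exact h2.trans ha1
    exact (real_inner_le_norm _ _).trans (mul_le_one₀ h3 (norm_nonneg _) (hL z hz))
  have h2 : ((↑) : F.map (G : _ →ₗ[ℝ] EuclideanSpace ℝ (Fin n)) → EuclideanSpace ℝ (Fin n)) ⁻¹' K
      ⊆ (4 / ε) • (S '' unitBallInf k) := by
    intro x hx
    set a := S.symm x with ha
    have hxa : x = S a := by simp [a]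
    rw [Set.mem_preimage, hxa, hS, hG _ (Submodule.coe_mem _)] at hx
    have h3 : ∀ j, a j ≤ 1 := fun j => by
      have := hx _ (hy j)
      rwa [hUy, U.apply_symm_apply] at this
    -- The vector y_j only bounds a_j from above; the negative multiple of its projection gives a_j
    -- ≥ -4/ε.
    have h4 : ∀ j, -(ε / 4) * a j ≤ 1 := fun j => by
      obtain ⟨z, hz, hzy⟩ := hneg j
      have h5 := hx z hz
      rw [← Submodule.inner_orthogonalProjectionOnto_eq_of_mem_left, hzy, inner_smul_right,
        Submodule.inner_orthogonalProjectionOnto_eq_of_mem_left, hUy, U.apply_symm_apply] at h5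
      exact h5
    refine ⟨S ((ε / 4) • a), ⟨_, fun j => ?_, rfl⟩, ?_⟩
    · rw [PiLp.smul_apply, smul_eq_mul, abs_le]
      constructor
      · linarith [h4 j]
      · nlinarith [h3 j]
    · simp only [map_smul, smul_smul]
      rw [div_mul_div_cancel₀ hε0.ne', div_self (by norm_num), one_smul, hxa]
  have hk : k ≤ n := by
    have := F.finrank_le
    rwa [hdim, finrank_euclideanSpace_fin] at this
  refine ⟨_, S, ?_, fun a j => ?_, h1, h2, ?_⟩
  · rw [← LinearEquiv.finrank_eq (G.submoduleMap F), hdim]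
  · rw [hS, G.symm_apply_apply, hUy, U.apply_symm_apply]
  · refine (banachMazurDist_unitBallInf_le S hk (by positivity) hκ0 h1 h2).trans (le_of_eq ?_)
    congr 1
    rw [hκ]
    field_simp
    ring

/-- The maximal determinant position exists for a compact set containing the unit ball. -/
theorem exists_isLoewnerPosition_image {L : Set (EuclideanSpace ℝ (Fin n))} (hLc : IsCompact L)
    (hL : Convex ℝ L) (hball : ∀ x, ‖x‖ ≤ 1 → x ∈ L) :
    ∃ (A : EuclideanSpace ℝ (Fin n) →ₗ[ℝ] EuclideanSpace ℝ (Fin n))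
      (b : EuclideanSpace ℝ (Fin n)), LinearMap.det A ≠ 0 ∧
      IsLoewnerPosition ((fun z => A z - b) '' L) := by
  let E := EuclideanSpace ℝ (Fin n)
  let D : Set ((E →L[ℝ] E) × E) := {p | ∀ z ∈ L, ‖p.1 z - p.2‖ ≤ 1}
  have hDclosed : IsClosed D := by
    have : D = ⋂ z ∈ L, {p | ‖p.1 z - p.2‖ ≤ 1} := by ext; simp [D]
    rw [this]
    exact isClosed_biInter fun z _ => isClosed_le (by fun_prop) continuous_const
  -- Evaluating at 0 gives ‖b‖ ≤ 1, and at unit vectors ‖A‖ ≤ 2.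
  have hDbdd : Bornology.IsBounded D := by
    refine (Metric.isBounded_closedBall (x := 0) (r := 2)).subset fun p hp => ?_
    have hb : ‖p.2‖ ≤ 1 := by simpa using hp 0 (hball 0 (by simp))
    rw [mem_closedBall_zero_iff, Prod.norm_def, max_le_iff]
    refine ⟨ContinuousLinearMap.opNorm_le_of_unit_norm (by norm_num) fun x hx => ?_, by linarith⟩
    calc ‖p.1 x‖ = ‖(p.1 x - p.2) + p.2‖ := by rw [sub_add_cancel]
      _ ≤ ‖p.1 x - p.2‖ + ‖p.2‖ := norm_add_le _ _
      _ ≤ 2 := by linarith [hp x (hball x hx.le)]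
  have : ProperSpace (E →L[ℝ] E) := FiniteDimensional.proper ℝ _
  have hDc : IsCompact D := Metric.isCompact_of_isClosed_isBounded hDclosed hDbdd
  obtain ⟨r, hr, hLr⟩ : ∃ r > 0, ∀ z ∈ L, ‖z‖ ≤ r := by
    obtain ⟨r, hr⟩ := hLc.isBounded.exists_norm_le
    exact ⟨max r 1, by positivity, fun z hz => (hr z hz).trans (le_max_left _ _)⟩
  -- A small dilation is admissible, so the maximal |det| is nonzero.
  have hmem : (r⁻¹ • ContinuousLinearMap.id ℝ E, (0 : E)) ∈ D := fun z hz => by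
    simp only [smul_apply, ContinuousLinearMap.id_apply, sub_zero, norm_smul]
    rw [Real.norm_of_nonneg (by positivity), inv_mul_le_iff₀ hr, mul_one]
    exact hLr z hz
  obtain ⟨⟨A, b⟩, hAb, hmax⟩ := hDc.exists_isMaxOn ⟨_, hmem⟩ (f := fun p => |p.1.det|)
    ((ContinuousLinearMap.continuous_det.comp continuous_fst).abs.continuousOn)
  have hA : 0 < |LinearMap.det (A : E →ₗ[ℝ] E)| := by
    have h1 : |(r⁻¹ • ContinuousLinearMap.id ℝ E).det| ≤ |A.det| := hmax hmem
    have h2 : (r⁻¹ • ContinuousLinearMap.id ℝ E).det = (r⁻¹) ^ n := by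
      have : (r⁻¹ • ContinuousLinearMap.id ℝ E).det =
        LinearMap.det (r⁻¹ • (LinearMap.id : E →ₗ[ℝ] E)) := rfl
      rw [this, LinearMap.det_smul, LinearMap.det_id, mul_one, finrank_euclideanSpace_fin]
    rw [h2] at h1
    exact (by positivity : 0 < |r⁻¹ ^ n|).trans_le h1
  refine ⟨A, b, abs_pos.1 hA, ?_, ?_, ⟨_, 0, hball 0 (by simp), rfl⟩, ?_, fun A' b' h => ?_⟩
  · exact hLc.image (A.continuous.sub continuous_const)
  · have h1 := (hL.linear_image A.toLinearMap).translate (-b)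
    rw [Set.image_image] at h1
    convert! h1 using 2
    simp [sub_eq_add_neg, add_comm]
  · rintro _ ⟨z, hz, rfl⟩
    exact hAb z hz
  · let A'' := LinearMap.toContinuousLinearMap A'
    have h1 : (A'' ∘L A, A' b + b') ∈ D := fun z hz => by
      have := h _ ⟨z, hz, rfl⟩
      simpa [A'', sub_sub] using this
    have h2 : |(A'' ∘L A).det| ≤ |A.det| := hmax h1
    have h3 : (A'' ∘L A).det = LinearMap.det (A' ∘ₗ (A : E →ₗ[ℝ] E)) := rfl
    rw [h3, LinearMap.det_comp, abs_mul] at h2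
    exact le_of_mul_le_mul_right (h2.trans_eq (one_mul _).symm) hA

theorem IsLoewnerPosition.exists_projection {K : Set (EuclideanSpace ℝ (Fin n))}
    (hK : IsLoewnerPosition K) {ε : ℝ} (hε0 : 0 < ε) (hε1 : ε < 1) :
    ∃ (k : ℕ) (F : Submodule ℝ (EuclideanSpace ℝ (Fin n)))
      (x : Fin k → EuclideanSpace ℝ (Fin n)) (T : EuclideanSpace ℝ (Fin k) ≃ₗ[ℝ] F),
      ⌊(1 - ε) * n⌋₊ ≤ k ∧ Module.finrank ℝ F = k ∧ (∀ j, x j ∈ contactPoints K) ∧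
      (∀ j, T (EuclideanSpace.single j 1) = F.orthogonalProjectionOnto (x j)) ∧
      (ε / 4) • (T '' unitBallOne k) ⊆ F.orthogonalProjectionOnto '' K ∧
      F.orthogonalProjectionOnto '' K ⊆ (16 / ε ^ 2) • (T '' unitBallTwo k) ∧
      banachMazurDist (F.orthogonalProjectionOnto '' K) (unitBallOne k) ≤
        ENNReal.ofReal (64 * √(n : ℝ) / ε ^ 3) := by
  obtain ⟨k, F, T, x, hk, hdim, hx, hx1, hT, hTκ, hneg⟩ := hK.exists_subspace hε0 hε1
  have hconv : Convex ℝ (F.orthogonalProjectionOnto '' K) :=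
    hK.convex.linear_image F.orthogonalProjectionOnto.toLinearMap
  have h0 : (0 : F) ∈ F.orthogonalProjectionOnto '' K := ⟨0, hK.zero_mem, map_zero _⟩
  have h1 : (ε / 4) • (T '' unitBallOne k) ⊆ F.orthogonalProjectionOnto '' K := by
    refine hconv.smul_image_unitBallOne_subset h0 T (fun j => ?_) fun j => ?_
    · rw [hT]
      exact hconv.smul_mem_of_zero_mem h0 ⟨_, hx j, rfl⟩ ⟨by positivity, by linarith⟩
    · rw [hT]
      exact hneg j
  have h2 : F.orthogonalProjectionOnto '' K ⊆ (16 / ε ^ 2) • (T '' unitBallTwo k) := by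
    rintro _ ⟨z, hz, rfl⟩
    set a := T.symm (F.orthogonalProjectionOnto z) with ha
    have h3 := hTκ a
    rw [ha, T.apply_symm_apply, ← ha] at h3
    refine ⟨T ((ε ^ 2 / 16) • a), ⟨_, ?_, rfl⟩, ?_⟩
    · rw [unitBallTwo, mem_closedBall_zero_iff, norm_smul, Real.norm_of_nonneg (by positivity)]
      exact h3.trans ((F.norm_orthogonalProjectionOnto_apply_le z).trans (hK.norm_le z hz))
    · simp only [map_smul, smul_smul]
      rw [div_mul_div_cancel₀ (by positivity), div_self (by norm_num), one_smul, ha,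
        T.apply_symm_apply]
  have hkn : k ≤ n := by
    have := F.finrank_le
    rwa [hdim, finrank_euclideanSpace_fin] at this
  refine ⟨k, F, x, T, hk, hdim, fun j => mem_contactPoints (hx j) (hx1 j) fun y hy => ?_, hT, h1,
    h2, ?_⟩
  · refine (real_inner_le_norm _ _).trans ?_
    rw [hx1, one_mul]
    exact hK.norm_le y hy
  · refine (banachMazurDist_unitBallOne_le T hkn (by positivity) (by positivity) h1 h2).trans
      (le_of_eq ?_)
    congr 1
    field_simp
    ring

/-- The polar of K need not be in Löwner position, but some affine image A(polar) - b is; the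
section is A*F with F orthogonal to b. -/
theorem IsLoewnerPosition.exists_section {K : Set (EuclideanSpace ℝ (Fin n))}
    (hK : IsLoewnerPosition K) {ε : ℝ} (hε0 : 0 < ε) (hε1 : ε < 1) :
    ∃ (k : ℕ) (F : Submodule ℝ (EuclideanSpace ℝ (Fin n)))
      (S : EuclideanSpace ℝ (Fin k) ≃ₗ[ℝ] F),
      ⌊(1 - ε) * n⌋₊ ≤ k ∧ Module.finrank ℝ F = k ∧
      (ε ^ 2 / 16) • (S '' unitBallTwo k) ⊆ ((↑) : F → EuclideanSpace ℝ (Fin n)) ⁻¹' K ∧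
      ((↑) : F → EuclideanSpace ℝ (Fin n)) ⁻¹' K ⊆ (4 / ε) • (S '' unitBallInf k) ∧
      banachMazurDist (((↑) : F → EuclideanSpace ℝ (Fin n)) ⁻¹' K) (unitBallInf k) ≤
        ENNReal.ofReal (64 * √(n : ℝ) / ε ^ 3) := by
  have hn0 : (0 : ℝ) ≤ n := n.cast_nonneg
  -- For small n the whole space works: S is dilation by ε/4, and (ε²/16)(ε/4) = ε³/64 times the
  -- ball lies in the ball of radius 1/n inside K. For large n, εn ≥ 8 leaves room for the extra
  -- direction b.
  rcases le_or_gt (n * ε ^ 3) 64 with hn | hn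
  · let S : EuclideanSpace ℝ (Fin n) ≃ₗ[ℝ] (⊤ : Submodule ℝ (EuclideanSpace ℝ (Fin n))) :=
      (LinearEquiv.smulOfNeZero ℝ _ (ε / 4) (by positivity)).trans Submodule.topEquiv.symm
    have hS : ∀ a, (S a : EuclideanSpace ℝ (Fin n)) = (ε / 4) • a := fun a => rfl
    have h1 : (ε ^ 2 / 16) • (S '' unitBallTwo n) ⊆
        ((↑) : (⊤ : Submodule ℝ (EuclideanSpace ℝ (Fin n))) → _) ⁻¹' K := by
      rintro _ ⟨_, ⟨a, ha, rfl⟩, rfl⟩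
      have ha1 : ‖a‖ ≤ 1 := by simpa [unitBallTwo] using ha
      refine hK.mem_of_norm_le ?_
      rw [Submodule.coe_smul, hS, smul_smul, norm_smul, Real.norm_of_nonneg (by positivity)]
      calc n * (ε ^ 2 / 16 * (ε / 4) * ‖a‖) = n * ε ^ 3 / 64 * ‖a‖ := by ring
        _ ≤ 1 := mul_le_one₀ (by linarith) (norm_nonneg _) ha1
    have h2 : ((↑) : (⊤ : Submodule ℝ (EuclideanSpace ℝ (Fin n))) → _) ⁻¹' K ⊆
        (4 / ε) • (S '' unitBallInf n) := by
      intro x hx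
      refine ⟨S (x : EuclideanSpace ℝ (Fin n)), ⟨_, fun j => ?_, rfl⟩, Subtype.ext ?_⟩
      · exact (PiLp.norm_apply_le (x : EuclideanSpace ℝ (Fin n)) j).trans (hK.norm_le _ hx)
      · simp only [Submodule.coe_smul, hS, smul_smul]
        rw [div_mul_div_cancel₀ hε0.ne', div_self (by norm_num), one_smul]
    refine ⟨n, ⊤, S, ?_, by simp, h1, h2, ?_⟩
    · exact Nat.floor_le_of_le (by nlinarith)
    · refine (banachMazurDist_unitBallInf_le S le_rfl (by positivity) (by positivity) h1
        h2).trans (le_of_eq ?_)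
      congr 1
      field_simp
      ring
  · have hn1 : (0 : ℝ) < n := by
      rcases hn0.eq_or_lt with h | h
      · rw [← h] at hn; norm_num at hn
      · exact h
    have hball : ∀ x, ‖x‖ ≤ 1 → x ∈ polarBody K := fun x hx y hy =>
      (real_inner_le_norm _ _).trans (mul_le_one₀ hx (norm_nonneg _) (hK.norm_le y hy))
    have hcomp : IsCompact (polarBody K) := by
      refine (isCompact_closedBall (0 : EuclideanSpace ℝ (Fin n)) (1 / (1 / n))).of_isClosed_subset
        isClosed_polarBody fun z hz => ?_
      rw [mem_closedBall_zero_iff]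
      refine norm_le_of_mem_polarBody (one_div_pos.2 hn1) (fun x hx => hK.mem_of_norm_le ?_) hz
      rwa [le_div_iff₀ hn1, mul_comm] at hx
    obtain ⟨A, b, hA, hL⟩ := exists_isLoewnerPosition_image hcomp convex_polarBody hball
    have hrank : (Module.finrank ℝ (Submodule.span ℝ {b}) : ℝ) ≤ 1 := by
      exact_mod_cast (finrank_span_le_card ({b} : Set (EuclideanSpace ℝ (Fin n)))).trans (by simp)
    have hεn : 8 ≤ ε * n := by
      have : n * ε ^ 3 ≤ ε * n := by nlinarith [mul_nonneg hn0 hε0.le, pow_le_one₀ hε0.le hε1.le (n := 2)]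
      linarith
    obtain ⟨k, F, T, y, hF, hk, hdim, hy, -, hT, hTκ, hneg⟩ :=
      hL.exists_subspace_of_le_mul hε0 hε1 (Submodule.span ℝ {b}) (by linarith)
    rw [← LinearMap.det_adjoint_real] at hA
    let G := (LinearMap.adjoint A).equivOfDetNeZero hA
    have hGA : ∀ x, G x = LinearMap.adjoint A x := fun x => rfl
    obtain ⟨F', S, h1, -, h2⟩ := exists_section_of_projection (K := K) hL.norm_le G hε0 hε1 F T y
      hdim hy hT hTκ hneg (fun f hf => by
        -- Orthogonality to b hides the translation: ⟨A*f, z⟩ = ⟨f, Az - b⟩ for z in the polar.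
        have hfb : inner ℝ f b = 0 := by
          rw [real_inner_comm]
          exact hF hf b (Submodule.mem_span_singleton_self b)
        rw [mem_iff_forall_polarBody hK.convex hK.isCompact.isClosed hK.zero_mem,
          Set.forall_mem_image]
        simp only [hGA, LinearMap.adjoint_inner_left, inner_sub_right, hfb, sub_zero])
    exact ⟨k, F', S, hk, h1, h2⟩

theorem exists_section_of_isMaxVolumeEllipsoid {K : Set (EuclideanSpace ℝ (Fin n))}
    (hKc : IsCompact K) (hK : Convex ℝ K) (h : IsMaxVolumeEllipsoid (unitBallTwo n) K) {ε : ℝ}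
    (hε0 : 0 < ε) (hε1 : ε < 1) :
    ∃ (k : ℕ) (F : Submodule ℝ (EuclideanSpace ℝ (Fin n)))
      (x : Fin k → EuclideanSpace ℝ (Fin n)) (S : EuclideanSpace ℝ (Fin k) ≃ₗ[ℝ] F),
      ⌊(1 - ε) * n⌋₊ ≤ k ∧ Module.finrank ℝ F = k ∧ (∀ j, x j ∈ contactPoints K) ∧
      (∀ (a : EuclideanSpace ℝ (Fin k)) (j : Fin k),
        inner ℝ (S a : EuclideanSpace ℝ (Fin n)) (x j) = a j) ∧
      (ε ^ 2 / 16) • (S '' unitBallTwo k) ⊆ ((↑) : F → EuclideanSpace ℝ (Fin n)) ⁻¹' K ∧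
      ((↑) : F → EuclideanSpace ℝ (Fin n)) ⁻¹' K ⊆ (4 / ε) • (S '' unitBallInf k) ∧
      banachMazurDist (((↑) : F → EuclideanSpace ℝ (Fin n)) ⁻¹' K) (unitBallInf k) ≤
        ENNReal.ofReal (64 * √(n : ℝ) / ε ^ 3) := by
  have hball : ∀ x, ‖x‖ ≤ 1 → x ∈ K := fun x hx => h.2.1 (by simpa [unitBallTwo] using hx)
  have hL := h.isLoewnerPosition_polarBody hKc hK
  obtain ⟨k, F, T, y, hk, hdim, hy, hy1, hT, hTκ, hneg⟩ := hL.exists_subspace hε0 hε1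
  obtain ⟨F', S, h1, h2, h3⟩ := exists_section_of_projection (K := K) hL.norm_le
    (LinearEquiv.refl ℝ _) hε0 hε1 F T y hdim hy hT hTκ hneg
    (fun f _ => mem_iff_forall_polarBody hK hKc.isClosed (hball 0 (by simp)))
  -- Each y_j is a unit vector, hence in K, and its membership in the polar is the supporting
  -- half-space that makes it a contact point.
  exact ⟨k, F', y, S, hk, h1,
    fun j => mem_contactPoints (hball _ (hy1 j).le) (hy1 j) (hy j), h2, h3⟩

end Sections
theorem mainTheorem5 (n : ℕ) (K : ConvexBody (EuclideanSpace ℝ (Fin n)))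
    (hK : (interior (K : Set (EuclideanSpace ℝ (Fin n)))).Nonempty)
    (ε : ℝ) (hε0 : 0 < ε) (hε1 : ε < 1) :
    (IsMinVolumeEllipsoid (unitBallTwo n) (K : Set (EuclideanSpace ℝ (Fin n))) →
      (∃ (k : ℕ) (F : Submodule ℝ (EuclideanSpace ℝ (Fin n)))
          (x : Fin k → EuclideanSpace ℝ (Fin n)) (T : EuclideanSpace ℝ (Fin k) ≃ₗ[ℝ] F),
        ⌊(1 - ε) * n⌋₊ ≤ k ∧ Module.finrank ℝ F = k ∧
        (∀ j, x j ∈ contactPoints (K : Set (EuclideanSpace ℝ (Fin n)))) ∧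
        (∀ j, T (EuclideanSpace.single j 1) = F.orthogonalProjectionOnto (x j)) ∧
        (ε / 4) • (T '' unitBallOne k) ⊆
          F.orthogonalProjectionOnto '' (K : Set (EuclideanSpace ℝ (Fin n))) ∧
        F.orthogonalProjectionOnto '' (K : Set (EuclideanSpace ℝ (Fin n))) ⊆
          (16 / ε ^ 2) • (T '' unitBallTwo k) ∧
        banachMazurDist (F.orthogonalProjectionOnto '' (K : Set (EuclideanSpace ℝ (Fin n))))
          (unitBallOne k) ≤ ENNReal.ofReal (64 * √(n : ℝ) / ε ^ 3)) ∧
      (∃ (k : ℕ) (F : Submodule ℝ (EuclideanSpace ℝ (Fin n)))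
          (S : EuclideanSpace ℝ (Fin k) ≃ₗ[ℝ] F),
        ⌊(1 - ε) * n⌋₊ ≤ k ∧ Module.finrank ℝ F = k ∧
        (ε ^ 2 / 16) • (S '' unitBallTwo k) ⊆
          ((↑) : F → EuclideanSpace ℝ (Fin n)) ⁻¹' (K : Set (EuclideanSpace ℝ (Fin n))) ∧
        ((↑) : F → EuclideanSpace ℝ (Fin n)) ⁻¹' (K : Set (EuclideanSpace ℝ (Fin n))) ⊆
          (4 / ε) • (S '' unitBallInf k) ∧
        banachMazurDist
          (((↑) : F → EuclideanSpace ℝ (Fin n)) ⁻¹' (K : Set (EuclideanSpace ℝ (Fin n))))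
          (unitBallInf k) ≤ ENNReal.ofReal (64 * √(n : ℝ) / ε ^ 3))) ∧
    (IsMaxVolumeEllipsoid (unitBallTwo n) (K : Set (EuclideanSpace ℝ (Fin n))) →
      ∃ (k : ℕ) (F : Submodule ℝ (EuclideanSpace ℝ (Fin n)))
          (x : Fin k → EuclideanSpace ℝ (Fin n)) (S : EuclideanSpace ℝ (Fin k) ≃ₗ[ℝ] F),
        ⌊(1 - ε) * n⌋₊ ≤ k ∧ Module.finrank ℝ F = k ∧
        (∀ j, x j ∈ contactPoints (K : Set (EuclideanSpace ℝ (Fin n)))) ∧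
        (∀ (a : EuclideanSpace ℝ (Fin k)) (j : Fin k),
          inner ℝ (S a : EuclideanSpace ℝ (Fin n)) (x j) = a j) ∧
        (ε ^ 2 / 16) • (S '' unitBallTwo k) ⊆
          ((↑) : F → EuclideanSpace ℝ (Fin n)) ⁻¹' (K : Set (EuclideanSpace ℝ (Fin n))) ∧
        ((↑) : F → EuclideanSpace ℝ (Fin n)) ⁻¹' (K : Set (EuclideanSpace ℝ (Fin n))) ⊆
          (4 / ε) • (S '' unitBallInf k) ∧
        banachMazurDist
          (((↑) : F → EuclideanSpace ℝ (Fin n)) ⁻¹' (K : Set (EuclideanSpace ℝ (Fin n))))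
          (unitBallInf k) ≤ ENNReal.ofReal (64 * √(n : ℝ) / ε ^ 3)) := by
  have hne : (K : Set (EuclideanSpace ℝ (Fin n))).Nonempty := hK.mono interior_subset
  refine ⟨fun h => ?_, fun h => exists_section_of_isMaxVolumeEllipsoid K.isCompact K.convex h
    hε0 hε1⟩
  have hL := h.isLoewnerPosition K.isCompact K.convex hne
  exact ⟨hL.exists_projection hε0 hε1, hL.exists_section hε0 hε1⟩
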